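/- Let $p$ be a prime. For $x\in p\mathbb{Z}_p=\{x\in\mathbb{Q}_p:|x|_p<1\}$, $x\neq 0$, put $a_1(x)=v_p(x)$, let $b_1(x)\in\{1,\dots,p-1\}$ be the unique integer with $b_1(x)\equiv p^{a_1(x)}/x \pmod p$, and let $T_p(x)=p^{a_1(x)}/x-b_1(x)$, $T_p(0)=0$ (the Schneider map). Let $a_i(x)=a_1(T_p^{i-1}x)$, $b_i(x)=b_1(T_p^{i-1}x)$, let $F=\bigcup_{k\ge 0}T_p^{-k}(0)$ be the set of points with finite continued fraction expansion, and for $x\notin F$ let $$\frac{p_m(x)}{q_m(x)}=\cfrac{p^{a_1(x)}}{b_1(x)+\cfrac{p^{a_2(x)}}{b_2(x)+\cdots\cfrac{p^{a_m(x)}}{b_m(x)}}}$$ be its convergents. For an integer $n\ge 1$ let $p\mathbb{Z}_{p,n}$ be the set of $x\in p\mathbb{Z}_p$ all of whose digits satisfy $a_i(x)\le n$, let $T_{p,n}$ be the restriction of $T_p$ to $p\mathbb{Z}_{p,n}\setminus F$, let $\psi(x)=p^{a_1(x)}$, and let $$P_n(-t\log\psi)=\sup_\mu\Big\{h_\mu(T_{p,n})-t\int\log\psi\,d\mu\Big\}\qquad(t\in\mathbb{R})$$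 be the topological pressure, the supremum being over all $T_{p,n}$-invariant Borel probability measures $\mu$ on $p\mathbb{Z}_{p,n}\setminus F$ with $\int\log\psi\,d\mu<\infty$, where $h_\mu$ is the measure-theoretic entropy. For $\alpha\in[\log p,\,n\log p]$ let $$A_n(\alpha)=\Big\{x\in p\mathbb{Z}_{p,n}\setminus F:\ -\lim_{m\to\infty}\frac1m\log\Big|x-\frac{p_m(x)}{q_m(x)}\Big|_p=\alpha\Big\},$$ and consider the equation $$-\alpha=\log p\cdot\Big(\frac{n}{p^{tn}-1}-\frac{p^t}{p^t-1}\Big),\qquad(\ast)$$ whose right-hand side is read at $t=0$ as its limit $-\frac{n+1}{2}\log p$. Let $\dim_{\mathrm H}$ denote Hausdorff dimension with respect to $|\cdot|_p$. 1. If $\log p<\alpha<n\log p$, then $(\ast)$ has a unique real solution $t=t_{\alpha,n}$. 2. For every $\alpha\in[\log p,n\log p]$ and every real solution $t$ of $(\ast)$, $$\dim_{\mathrm H}A_n(\alpha)=\frac1\alpha P_n(-t\log\psi)+t.$$ In particular, $\dim_{\mathrm H}A_n(\alpha)=\frac1\alpha P_n(-t_{\alpha,n}\log\psi)+t_{\alpha,n}$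 for $\log p<\alpha<n\log p$. 3. At the end points the formula holds in the limit: $$\dim_{\mathrm H}A_n(\log p)=\lim_{t\to+\infty}\Big(\frac{1}{\log p}P_n(-t\log\psi)+t\Big),\qquad \dim_{\mathrm H}A_n(n\log p)=\lim_{t\to-\infty}\Big(\frac{1}{n\log p}P_n(-t\log\psi)+t\Big).$$ -/

import Mathlib

open Filter Topology MeasureTheory

noncomputable section

namespace Schneider

/-! ### Measure-theoretic entropy and topological pressure -/

section Thermodynamic

variable {X : Type*} [MeasurableSpace X]

/-- Shannon entropy (natural logarithm) of the join `Q ∨ T⁻¹Q ∨ ⋯ ∨ T^{-(m-1)}Q`, where the finite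
measurable partition `{Q⁻¹(j)}` is given by its label function `Q : X → Fin k`. The atoms of the
join are indexed by the words `w` of length `m`. -/
def joinEntropy (T : X → X) (μ : Measure X) {k : ℕ} (Q : X → Fin k) (m : ℕ) : ℝ :=
  ∑ w : Fin m → Fin k, Real.negMulLog (μ.real {x | ∀ i : Fin m, Q (T^[i] x) = w i})

/-- The entropy `h_μ(T, Q) = lim_m (1/m) H_μ(Q ∨ ⋯ ∨ T^{-(m-1)}Q)` of `T` relative to a finite
partition (written as a limsup; the limit exists when `μ` is `T`-invariant). -/
def partitionEntropy (T : X → X) (μ : Measure X) {k : ℕ} (Q : X → Fin k) : EReal :=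
  limsup (fun m : ℕ => ((joinEntropy T μ Q m / m : ℝ) : EReal)) atTop

/-- The measure-theoretic (Kolmogorov–Sinai) entropy `h_μ(T)`: the supremum of `h_μ(T, Q)` over all
finite measurable partitions `Q`. -/
def entropy (T : X → X) (μ : Measure X) : EReal :=
  ⨆ (k : ℕ) (Q : X → Fin k) (_ : Measurable Q), partitionEntropy T μ Q

/-- The topological pressure `P(ρ) = sup { h_μ + ∫ ρ dμ }`, the supremum over all `T`-invariant
probability measures `μ` for which `∫ ρ dμ` is finite. -/
def pressure (T : X → X) (ρ : X → ℝ) : EReal :=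
  ⨆ (μ : Measure X) (_ : IsProbabilityMeasure μ) (_ : MeasurePreserving T μ μ)
    (_ : Integrable ρ μ), entropy T μ + ((∫ x, ρ x ∂μ : ℝ) : EReal)

end Thermodynamic

/-! ### The Schneider map -/

section Map

variable (p : ℕ) [Fact p.Prime]

instance instMeasurableSpacePadic : MeasurableSpace ℚ_[p] := borel ℚ_[p]

instance instBorelSpacePadic : BorelSpace ℚ_[p] := ⟨rfl⟩

/-- The ball `pℤ_p = {x ∈ ℚ_p : |x|_p < 1}`. -/
def pZp : Set ℚ_[p] := {x | ‖x‖ < 1}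

variable {p}

/-- The first digit `a₁(x) = v_p(x)`. -/
def a₁ (x : ℚ_[p]) : ℤ := x.valuation

/-- The first digit `b₁(x)`: the unique `b ∈ {1, …, p - 1}` with `b ≡ p^{a₁(x)} / x (mod p)`
(for `x ≠ 0`). -/
def b₁ (x : ℚ_[p]) : ℕ :=
  sInf {b : ℕ | b ∈ Finset.Icc 1 (p - 1) ∧ ‖(p : ℚ_[p]) ^ a₁ x / x - b‖ < 1}

open Classical in
/-- The Schneider map `T_p(0) = 0`, `T_p(x) = p^{a₁(x)} / x - b₁(x)` for `x ≠ 0`. -/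
def T (x : ℚ_[p]) : ℚ_[p] :=
  if x = 0 then 0 else (p : ℚ_[p]) ^ a₁ x / x - b₁ x

/-- The convergent `p_m(x)/q_m(x)`: the continued fraction
`p^{a₁(x)} / (b₁(x) + p^{a₂(x)} / (b₂(x) + ⋯ + p^{a_m(x)} / b_m(x)))`, where `a_{i+1} = a_i ∘ T_p`
and `b_{i+1} = b_i ∘ T_p`. -/
def convergent : ℕ → ℚ_[p] → ℚ_[p]
  | 0, _ => 0
  | m + 1, x => (p : ℚ_[p]) ^ a₁ x / (b₁ x + convergent m (T x))

/-- The function `ψ(x) = p^{a₁(x)}`. -/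
def ψ (x : ℚ_[p]) : ℝ := (p : ℝ) ^ a₁ x

lemma norm_pow_a₁_div {x : ℚ_[p]} (hx : x ≠ 0) : ‖(p : ℚ_[p]) ^ a₁ x / x‖ = 1 := by
  have hx' : ‖x‖ ≠ 0 := norm_ne_zero_iff.mpr hx
  rw [norm_div, Padic.norm_p_zpow, a₁, ← Padic.norm_eq_zpow_neg_valuation hx, div_self hx']

/-- The defining property of `b₁(x)`. -/
lemma b₁_spec {x : ℚ_[p]} (hx : x ≠ 0) :
    b₁ x ∈ Finset.Icc 1 (p - 1) ∧ ‖(p : ℚ_[p]) ^ a₁ x / x - b₁ x‖ < 1 := by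
  have hu := norm_pow_a₁_div hx
  let u : ℤ_[p] := ⟨(p : ℚ_[p]) ^ a₁ x / x, hu.le⟩
  have h1 : ‖u - (u.zmodRepr : ℤ_[p])‖ < 1 := PadicInt.norm_sub_zmodRepr_lt_one u
  have h2 : u.zmodRepr < p := PadicInt.zmodRepr_lt_p u
  have h3 : u.zmodRepr ≠ 0 := by
    intro h0
    rw [h0, Nat.cast_zero, sub_zero] at h1
    have : ‖u‖ = 1 := hu
    linarith
  refine Nat.sInf_mem (s := {b : ℕ | b ∈ Finset.Icc 1 (p - 1) ∧
    ‖(p : ℚ_[p]) ^ a₁ x / x - b‖ < 1}) ⟨u.zmodRepr, ?_, ?_⟩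
  · rw [Finset.mem_Icc]
    omega
  · have h4 : ‖((u - (u.zmodRepr : ℤ_[p]) : ℤ_[p]) : ℚ_[p])‖ < 1 := h1
    rw [PadicInt.coe_sub, PadicInt.coe_natCast] at h4
    exact h4

lemma mapsTo_T_pZp : Set.MapsTo (T (p := p)) (pZp p) (pZp p) := by
  intro x _
  by_cases hx : x = 0
  · simp [T, hx, pZp]
  · simpa [T, hx, pZp] using (b₁_spec hx).2

variable (p)

/-- The set `F` of points of `pℤ_p` with a finite continued fraction expansion. -/
def F : Set ℚ_[p] := {x | x ∈ pZp p ∧ ∃ k : ℕ, T^[k] x = 0}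

/-- The set `pℤ_{p,n}` of points of `pℤ_p` all of whose digits `a_i(x) = a₁(T_p^{i-1} x)` are at
most `n`. -/
def pZpBounded (n : ℕ) : Set ℚ_[p] := {x | x ∈ pZp p ∧ ∀ k : ℕ, a₁ (T^[k] x) ≤ n}

lemma mapsTo_T (n : ℕ) :
    Set.MapsTo (T (p := p)) (pZpBounded p n \ F p) (pZpBounded p n \ F p) := by
  rintro x ⟨⟨h1, h2⟩, h3⟩
  refine ⟨⟨mapsTo_T_pZp h1, fun k => h2 (k + 1)⟩, ?_⟩
  rintro ⟨_, k, hk⟩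
  exact h3 ⟨h1, k + 1, hk⟩

/-- The restricted map `T_{p,n}`, as a self-map of `pℤ_{p,n} ∖ F`. -/
def Tn (n : ℕ) : ↥(pZpBounded p n \ F p) → ↥(pZpBounded p n \ F p) :=
  (mapsTo_T p n).restrict

/-- `P_n(-t log ψ)`: the topological pressure of `-t log ψ` for `T_{p,n}` on `pℤ_{p,n} ∖ F`. -/
def Pn (n : ℕ) (t : ℝ) : EReal :=
  pressure (Tn p n) (fun x => -t * Real.log (ψ (x : ℚ_[p])))

/-- The function `t ↦ log p · (n / (p^{tn} - 1) - p^t / (p^t - 1))`, extended to its removable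
singularity `t = 0` by its limit `-((n + 1) / 2) log p`. -/
def slope (n : ℕ) (t : ℝ) : ℝ :=
  if t = 0 then -(((n : ℝ) + 1) / 2) * Real.log p
  else Real.log p *
    (n / ((p : ℝ) ^ (t * n) - 1) - (p : ℝ) ^ t / ((p : ℝ) ^ t - 1))

/-- The points of `pℤ_{p,n} ∖ F` whose convergents approximate at exponential rate `α`:
`-lim_m (1/m) log |x - p_m(x)/q_m(x)|_p = α`. -/
def approxSet (n : ℕ) (α : ℝ) : Set ℚ_[p] :=
  {x | x ∈ pZpBounded p n \ F p ∧
    Tendsto (fun m : ℕ => -(1 / (m : ℝ) * Real.log ‖x - convergent m x‖)) atTop (𝓝 α)}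

end Map

end Schneider

end

noncomputable section

namespace Schneider

/-! For `‖y‖ < 1` the denominator `b + y` is a unit, so the inverse branch `y ↦ p^a / (b + y)`
scales distances by exactly `p^{-a}`. Hence `code` conjugates the full shift on `Digit p n` to
`T_{p,n}`. Writing `S_m` for the sum of the first `m` exponents, the `m`-th convergent has error
exactly `p^{-S_{m+1}}`, and two points agree in `m` digits as soon as they are closer than
`p^{-S_m}`. So `A_n(α)` consists of the codes along which the averages of `a · log p` tend to `α`
(`code_mem_approxSet_iff`).

Since `log ψ` depends only on the first digit, the pressure is `log Z(t)` with `Z(t) = ∑_{a,b}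
p^{-ta}` (`Pn_eq`). Gibbs' inequality bounds the free energy of every invariant measure, and the
Bernoulli measure with weights `p^{-ta} / Z(t)` attains the bound.

Covering by cylinders gives `dim ≤ log Z(t) / α + t` for every real `t` (`dimH_approxSet_le`).
Conversely, the law of large numbers and the mass distribution principle give `dim ≥ entropy / α`
for every digit law of mean `α` (`le_dimH_approxSet`). The right side of the slope equation is the
logarithmic derivative of `Z`, so the equation says that the Gibbs law has mean `α`. Its entropy is
then `log Z(t) + tα`, and the two bounds meet. At an end point the uniform law on the digits with
the extreme exponent has entropy `log (p - 1)`, and the upper bounds converge to the matching value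
as `t → ±∞`. Uniqueness of the solution holds because `∑ c_i e^{-t c_i}` is strictly decreasing and
changes sign. -/

/-- The alphabet of the full shift coding `T_{p,n}`: the pair `(i, j)` stands for the digits
`a = i + 1` and `b = j + 1`. -/
abbrev Digit (p n : ℕ) := Fin n × Fin (p - 1)

/-! ### Continued fractions as a symbolic coding by similarities -/

section Coding

variable {p n : ℕ}

/-- The exponent `a` of a digit. -/
def expo (d : Digit p n) : ℕ := d.1 + 1

/-- The residue `b` of a digit. -/
def resid (d : Digit p n) : ℕ := d.2 + 1

lemma one_le_expo (d : Digit p n) : 1 ≤ expo d := by simp [expo]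

lemma expo_le (d : Digit p n) : expo d ≤ n := d.1.2

lemma resid_mem (d : Digit p n) : resid d ∈ Finset.Icc 1 (p - 1) := by
  have := d.2.2
  rw [Finset.mem_Icc, resid]
  omega

lemma digit_ext {d e : Digit p n} (h1 : expo d = expo e) (h2 : resid d = resid e) : d = e := by
  simp only [expo, resid, add_left_inj] at h1 h2
  exact Prod.ext (Fin.ext h1) (Fin.ext h2)

/-- The left shift on digit sequences. -/
def shift {D : Type*} (ω : ℕ → D) : ℕ → D := fun i => ω (i + 1)

lemma shift_iterate {D : Type*} (k : ℕ) (ω : ℕ → D) : shift^[k] ω = fun i => ω (i + k) := by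
  induction k generalizing ω with
  | zero => rfl
  | succ k ih =>
    rw [Function.iterate_succ_apply, ih]
    funext i
    simp [shift, add_assoc]

/-- The sum of the first `m` exponents of a digit sequence. -/
def expoSum (m : ℕ) (ω : ℕ → Digit p n) : ℕ := ∑ i ∈ Finset.range m, expo (ω i)

lemma expoSum_succ (m : ℕ) (ω : ℕ → Digit p n) :
    expoSum (m + 1) ω = expoSum m ω + expo (ω m) := Finset.sum_range_succ _ _

lemma expoSum_succ' (m : ℕ) (ω : ℕ → Digit p n) :
    expoSum (m + 1) ω = expo (ω 0) + expoSum m (shift ω) := by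
  rw [add_comm (expo _)]
  exact Finset.sum_range_succ' (fun i => expo (ω i)) m

lemma le_expoSum (m : ℕ) (ω : ℕ → Digit p n) : m ≤ expoSum m ω := by
  simpa [expoSum] using Finset.card_nsmul_le_sum (Finset.range m) (fun i => expo (ω i)) 1
    fun i _ => one_le_expo _

lemma expoSum_mono (ω : ℕ → Digit p n) : Monotone fun m => expoSum m ω :=
  monotone_nat_of_le_succ fun m => by rw [expoSum_succ]; omega

lemma expoSum_congr {m : ℕ} {ω ω' : ℕ → Digit p n} (h : ∀ i < m, ω i = ω' i) :
    expoSum m ω = expoSum m ω' :=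
  Finset.sum_congr rfl fun i hi => by rw [h i (Finset.mem_range.mp hi)]

lemma expoSum_le (m : ℕ) (ω : ℕ → Digit p n) : expoSum m ω ≤ n * m := by
  simpa [expoSum, mul_comm] using Finset.sum_le_card_nsmul (Finset.range m) (fun i => expo (ω i)) n
    fun i _ => expo_le _

variable [Fact p.Prime]

lemma one_lt_prime_cast : (1 : ℝ) < p := by exact_mod_cast (Fact.out : p.Prime).one_lt

lemma prime_cast_pos : (0 : ℝ) < p := zero_lt_one.trans one_lt_prime_cast

lemma log_prime_pos : 0 < Real.log p := Real.log_pos one_lt_prime_cast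

lemma norm_natCast_eq_one_of_mem {b : ℕ} (hb : b ∈ Finset.Icc 1 (p - 1)) :
    ‖(b : ℚ_[p])‖ = 1 := by
  rw [Finset.mem_Icc] at hb
  rw [Padic.norm_natCast_eq_one_iff]
  exact Nat.coprime_of_lt_prime (by omega) (by omega) Fact.out

lemma norm_sub_le_max (x y : ℚ_[p]) : ‖x - y‖ ≤ max ‖x‖ ‖y‖ := by
  simpa [sub_eq_add_neg] using IsUltrametricDist.norm_add_le_max x (-y)

lemma norm_add_eq_one {u y : ℚ_[p]} (hu : ‖u‖ = 1) (hy : ‖y‖ < 1) : ‖u + y‖ = 1 := by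
  rw [IsUltrametricDist.norm_add_eq_max_of_norm_ne_norm (by rw [hu]; exact hy.ne'), hu,
    max_eq_left hy.le]

lemma eq_of_norm_natCast_sub_lt_one {b c : ℕ} (hb : b ∈ Finset.Icc 1 (p - 1))
    (hc : c ∈ Finset.Icc 1 (p - 1)) (h : ‖(b : ℚ_[p]) - c‖ < 1) : b = c := by
  rw [Finset.mem_Icc] at hb hc
  have h1 : ‖((b - c : ℤ) : ℚ_[p])‖ < 1 := by push_cast; exact h
  rw [Padic.norm_intCast_lt_one_iff] at h1
  have h2 : (b - c : ℤ) = 0 := by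
    refine Int.eq_zero_of_abs_lt_dvd h1 ?_
    rw [abs_lt]
    constructor <;> omega
  omega

lemma b₁_eq {x : ℚ_[p]} (hx : x ≠ 0) {b : ℕ} (hb : b ∈ Finset.Icc 1 (p - 1))
    (h : ‖(p : ℚ_[p]) ^ a₁ x / x - b‖ < 1) : b₁ x = b := by
  obtain ⟨h1, h2⟩ := b₁_spec hx
  refine eq_of_norm_natCast_sub_lt_one h1 hb ?_
  have : (b₁ x : ℚ_[p]) - b =
      ((p : ℚ_[p]) ^ a₁ x / x - b) - ((p : ℚ_[p]) ^ a₁ x / x - b₁ x) := by ring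
  rw [this]
  exact (norm_sub_le_max _ _).trans_lt (max_lt h h2)

lemma a₁_eq_of_norm {x : ℚ_[p]} {k : ℤ} (h : ‖x‖ = (p : ℝ) ^ (-k)) : a₁ x = k := by
  have hx : x ≠ 0 := by
    rintro rfl
    rw [norm_zero] at h
    exact (zpow_pos prime_cast_pos (-k)).ne h
  rw [Padic.norm_eq_zpow_neg_valuation hx] at h
  have := zpow_right_injective₀ prime_cast_pos one_lt_prime_cast.ne' h
  simpa [a₁] using this

/-- The first digits are constant on the ball of radius `‖x‖` about `x ≠ 0`. -/
lemma digits_eq_of_norm_sub_lt {x y : ℚ_[p]} (h : ‖x - y‖ < ‖x‖) :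
    a₁ y = a₁ x ∧ b₁ y = b₁ x := by
  have hx : x ≠ 0 := by
    rintro rfl
    exact absurd h (by simp)
  have hn : ‖y‖ = ‖x‖ := by
    have h' := IsUltrametricDist.norm_add_eq_max_of_norm_ne_norm (x := x) (y := y - x)
      (by rw [norm_sub_rev]; exact h.ne')
    rw [add_sub_cancel, norm_sub_rev, max_eq_left h.le] at h'
    exact h'
  have hx0 : 0 < ‖x‖ := norm_pos_iff.mpr hx
  have hy : y ≠ 0 := by rw [← norm_pos_iff, hn]; exact hx0
  have ha : a₁ y = a₁ x := a₁_eq_of_norm (by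
    rw [hn, Padic.norm_eq_zpow_neg_valuation hx, a₁])
  refine ⟨ha, b₁_eq hy (b₁_spec hx).1 ?_⟩
  -- The relative error `(x - y) / y` has norm below 1, so the unit `p^a / x` keeps its residue when
  -- `x` is replaced by `y`.
  have : (p : ℚ_[p]) ^ a₁ y / y - b₁ x =
      (p : ℚ_[p]) ^ a₁ x / x * ((x - y) / y) + ((p : ℚ_[p]) ^ a₁ x / x - b₁ x) := by
    rw [ha]; field_simp; ring
  rw [this]
  refine (IsUltrametricDist.norm_add_le_max _ _).trans_lt (max_lt ?_ (b₁_spec hx).2)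
  rw [norm_mul, norm_pow_a₁_div hx, one_mul, norm_div, hn, div_lt_one hx0]
  exact h

/-- The inverse branch `y ↦ p^a / (b + y)` of the Schneider map. -/
def branch (d : Digit p n) (y : ℚ_[p]) : ℚ_[p] := (p : ℚ_[p]) ^ expo d / (resid d + y)

lemma norm_resid_add (d : Digit p n) {y : ℚ_[p]} (hy : ‖y‖ < 1) :
    ‖(resid d : ℚ_[p]) + y‖ = 1 :=
  norm_add_eq_one (norm_natCast_eq_one_of_mem (resid_mem d)) hy

lemma resid_add_ne_zero (d : Digit p n) {y : ℚ_[p]} (hy : ‖y‖ < 1) :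
    (resid d : ℚ_[p]) + y ≠ 0 := by
  rw [← norm_ne_zero_iff, norm_resid_add d hy]
  exact one_ne_zero

lemma norm_branch (d : Digit p n) {y : ℚ_[p]} (hy : ‖y‖ < 1) :
    ‖branch d y‖ = ((p : ℝ) ^ expo d)⁻¹ := by
  rw [branch, norm_div, norm_resid_add d hy, div_one, norm_pow, Padic.norm_p, inv_pow]

lemma pow_expo_inv_le_half (d : Digit p n) : ((p : ℝ) ^ expo d)⁻¹ ≤ 1 / 2 := by
  rw [one_div]
  refine inv_anti₀ two_pos ?_
  have h2 : (2 : ℝ) ≤ p := by exact_mod_cast (Fact.out : p.Prime).two_le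
  exact h2.trans (le_self_pow₀ one_lt_prime_cast.le (Nat.one_le_iff_ne_zero.mp (one_le_expo d)))

lemma norm_branch_le_half (d : Digit p n) {y : ℚ_[p]} (hy : ‖y‖ < 1) : ‖branch d y‖ ≤ 1 / 2 :=
  (norm_branch d hy).trans_le (pow_expo_inv_le_half d)

/-- Both denominators are units, so this is an equality and not just a contraction estimate; all
later sizes are exact because of it. -/
lemma norm_branch_sub (d : Digit p n) {y z : ℚ_[p]} (hy : ‖y‖ < 1) (hz : ‖z‖ < 1) :
    ‖branch d y - branch d z‖ = ((p : ℝ) ^ expo d)⁻¹ * ‖y - z‖ := by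
  have h1 := resid_add_ne_zero d hy
  have h2 := resid_add_ne_zero d hz
  have : branch d y - branch d z =
      (p : ℚ_[p]) ^ expo d * (z - y) / ((resid d + y) * (resid d + z)) := by
    rw [branch, branch]; field_simp; ring
  rw [this, norm_div, norm_mul, norm_mul, norm_resid_add d hy, norm_resid_add d hz, mul_one,
    div_one, norm_pow, Padic.norm_p, inv_pow, norm_sub_rev]

lemma branch_ne_zero (d : Digit p n) {y : ℚ_[p]} (hy : ‖y‖ < 1) : branch d y ≠ 0 := by
  rw [← norm_pos_iff, norm_branch d hy]
  exact inv_pos.mpr (pow_pos prime_cast_pos _)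

lemma a₁_branch (d : Digit p n) {y : ℚ_[p]} (hy : ‖y‖ < 1) : a₁ (branch d y) = expo d :=
  a₁_eq_of_norm (by rw [norm_branch d hy, zpow_neg, zpow_natCast])

lemma pow_a₁_branch_div (d : Digit p n) {y : ℚ_[p]} (hy : ‖y‖ < 1) :
    (p : ℚ_[p]) ^ a₁ (branch d y) / branch d y = resid d + y := by
  have h1 := resid_add_ne_zero d hy
  have hp : (p : ℚ_[p]) ≠ 0 := by exact_mod_cast (Fact.out : p.Prime).ne_zero
  rw [a₁_branch d hy, branch, zpow_natCast]
  field_simp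

lemma b₁_branch (d : Digit p n) {y : ℚ_[p]} (hy : ‖y‖ < 1) : b₁ (branch d y) = resid d :=
  b₁_eq (branch_ne_zero d hy) (resid_mem d) (by
    rw [pow_a₁_branch_div d hy, add_sub_cancel_left]; exact hy)

lemma T_branch (d : Digit p n) {y : ℚ_[p]} (hy : ‖y‖ < 1) : T (branch d y) = y := by
  rw [T, if_neg (branch_ne_zero d hy), pow_a₁_branch_div d hy, b₁_branch d hy,
    add_sub_cancel_left]

/-- The continued fraction with the first `m` digits of `ω`. -/
def codeApprox : ℕ → (ℕ → Digit p n) → ℚ_[p]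
  | 0, _ => 0
  | m + 1, ω => branch (ω 0) (codeApprox m (shift ω))

/-- A bound away from 1, so that the limit `code ω` still lies in the open unit ball. -/
lemma norm_codeApprox_le_half (m : ℕ) (ω : ℕ → Digit p n) : ‖codeApprox m ω‖ ≤ 1 / 2 := by
  induction m generalizing ω with
  | zero => simp [codeApprox]
  | succ m ih => exact norm_branch_le_half _ ((ih _).trans_lt (by norm_num))

lemma norm_codeApprox_lt_one (m : ℕ) (ω : ℕ → Digit p n) : ‖codeApprox m ω‖ < 1 :=
  (norm_codeApprox_le_half m ω).trans_lt (by norm_num)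

lemma dist_codeApprox_succ_le (m : ℕ) (ω : ℕ → Digit p n) :
    dist (codeApprox m ω) (codeApprox (m + 1) ω) ≤ 1 * (1 / 2) ^ m := by
  induction m generalizing ω with
  | zero =>
    rw [dist_eq_norm, norm_sub_rev]
    simpa [codeApprox] using (norm_codeApprox_lt_one 1 ω).le
  | succ m ih =>
    rw [dist_eq_norm]
    change ‖branch _ (codeApprox m (shift ω)) - branch _ (codeApprox (m + 1) (shift ω))‖ ≤ _
    rw [norm_branch_sub _ (norm_codeApprox_lt_one _ _) (norm_codeApprox_lt_one _ _), pow_succ',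
      ← mul_assoc, mul_comm (1 : ℝ), mul_assoc]
    refine mul_le_mul (pow_expo_inv_le_half _) ?_ (norm_nonneg _) (by norm_num)
    rw [← dist_eq_norm]
    exact ih _

/-- The point with infinite continued fraction expansion `ω`. -/
def code (ω : ℕ → Digit p n) : ℚ_[p] := limUnder atTop fun m => codeApprox m ω

lemma tendsto_codeApprox (ω : ℕ → Digit p n) :
    Tendsto (fun m => codeApprox m ω) atTop (𝓝 (code ω)) :=
  (cauchySeq_of_le_geometric (1 / 2) 1 (by norm_num)
    fun m => dist_codeApprox_succ_le m ω).tendsto_limUnder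

lemma norm_code_lt_one (ω : ℕ → Digit p n) : ‖code ω‖ < 1 :=
  (le_of_tendsto' (tendsto_codeApprox ω).norm fun m => norm_codeApprox_le_half m ω).trans_lt
    (by norm_num)

lemma code_eq (ω : ℕ → Digit p n) : code ω = branch (ω 0) (code (shift ω)) := by
  refine tendsto_nhds_unique ((tendsto_codeApprox ω).comp (tendsto_add_atTop_nat 1)) ?_
  exact tendsto_const_nhds.div (tendsto_const_nhds.add (tendsto_codeApprox (shift ω)))
    (resid_add_ne_zero _ (norm_code_lt_one _))

lemma a₁_code (ω : ℕ → Digit p n) : a₁ (code ω) = expo (ω 0) := by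
  rw [code_eq, a₁_branch _ (norm_code_lt_one _)]

lemma b₁_code (ω : ℕ → Digit p n) : b₁ (code ω) = resid (ω 0) := by
  rw [code_eq, b₁_branch _ (norm_code_lt_one _)]

lemma T_code (ω : ℕ → Digit p n) : T (code ω) = code (shift ω) := by
  rw [code_eq, T_branch _ (norm_code_lt_one _)]

lemma norm_code (ω : ℕ → Digit p n) : ‖code ω‖ = ((p : ℝ) ^ expo (ω 0))⁻¹ := by
  rw [code_eq, norm_branch _ (norm_code_lt_one _)]

lemma code_ne_zero (ω : ℕ → Digit p n) : code ω ≠ 0 := by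
  rw [code_eq]; exact branch_ne_zero _ (norm_code_lt_one _)

lemma T_iterate_code (k : ℕ) (ω : ℕ → Digit p n) : T^[k] (code ω) = code (shift^[k] ω) :=
  (Function.Semiconj.iterate_right (f := code) (fun ω => (T_code ω).symm) k ω).symm

lemma code_mem (ω : ℕ → Digit p n) : code ω ∈ pZpBounded p n \ F p := by
  refine ⟨⟨norm_code_lt_one ω, fun k => ?_⟩, ?_⟩
  · rw [T_iterate_code, a₁_code]
    exact_mod_cast expo_le _
  · rintro ⟨_, k, hk⟩
    rw [T_iterate_code] at hk
    exact code_ne_zero _ hk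

lemma convergent_code (m : ℕ) (ω : ℕ → Digit p n) : convergent m (code ω) = codeApprox m ω := by
  induction m generalizing ω with
  | zero => rfl
  | succ m ih =>
    rw [convergent, T_code, ih, a₁_code, b₁_code, zpow_natCast]
    rfl

/-- Truncation replaces the tail, a point of norm `p^{-a_{m+1}}`, by 0, and the `m` branches scale
this error by `p^{-S_m}`. This accounts for `m + 1` digits in the exponent. -/
lemma norm_code_sub_codeApprox (m : ℕ) (ω : ℕ → Digit p n) :
    ‖code ω - codeApprox m ω‖ = ((p : ℝ) ^ expoSum (m + 1) ω)⁻¹ := by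
  induction m generalizing ω with
  | zero => simp [codeApprox, norm_code, expoSum]
  | succ m ih =>
    rw [code_eq, codeApprox, norm_branch_sub _ (norm_code_lt_one _) (norm_codeApprox_lt_one _ _),
      ih, expoSum_succ' (m + 1), pow_add, mul_inv]

lemma norm_code_sub_le {m : ℕ} {ω ω' : ℕ → Digit p n} (h : ∀ i < m, ω i = ω' i) :
    ‖code ω - code ω'‖ ≤ ((p : ℝ) ^ expoSum m ω)⁻¹ := by
  induction m generalizing ω ω' with
  | zero =>
    simpa [expoSum] using (norm_sub_le_max _ _).trans
      (max_le (norm_code_lt_one ω).le (norm_code_lt_one ω').le)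
  | succ m ih =>
    rw [code_eq ω, code_eq ω', ← h 0 m.succ_pos,
      norm_branch_sub _ (norm_code_lt_one _) (norm_code_lt_one _), expoSum_succ', pow_add, mul_inv]
    exact mul_le_mul_of_nonneg_left (ih fun i hi => h (i + 1) (by omega))
      (inv_nonneg.mpr (pow_pos prime_cast_pos _).le)

/-- Being closer than `‖code ω‖` forces equal first digits; the common branch is a similarity and
can be stripped off, leaving the same claim for the shifts. -/
lemma eq_of_norm_code_sub_lt {m : ℕ} {ω ω' : ℕ → Digit p n}
    (h : ‖code ω - code ω'‖ < ((p : ℝ) ^ expoSum m ω)⁻¹) : ∀ i < m, ω i = ω' i := by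
  induction m generalizing ω ω' with
  | zero => simp
  | succ m ih =>
    have h0 : ω 0 = ω' 0 := by
      have h1 : ‖code ω - code ω'‖ < ‖code ω‖ := by
        rw [norm_code]
        refine h.trans_le (inv_anti₀ (pow_pos prime_cast_pos _) ?_)
        exact pow_le_pow_right₀ one_lt_prime_cast.le (by rw [expoSum_succ']; omega)
      obtain ⟨h2, h3⟩ := digits_eq_of_norm_sub_lt h1
      rw [a₁_code, a₁_code] at h2
      rw [b₁_code, b₁_code] at h3
      exact digit_ext (by exact_mod_cast h2.symm) h3.symm
    rw [code_eq ω, code_eq ω', ← h0,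
      norm_branch_sub _ (norm_code_lt_one _) (norm_code_lt_one _), expoSum_succ', pow_add,
      mul_inv] at h
    have h4 := ih (lt_of_mul_lt_mul_left h (inv_nonneg.mpr (pow_pos prime_cast_pos _).le))
    rintro (_ | i) hi
    · exact h0
    · exact h4 i (by omega)

lemma continuous_codeApprox (m : ℕ) : Continuous (codeApprox (p := p) (n := n) m) := by
  induction m with
  | zero => exact continuous_const
  | succ m ih =>
    have h0 : Continuous fun ω : ℕ → Digit p n => ω 0 := continuous_apply 0
    refine Continuous.div ?_ ?_ fun ω => resid_add_ne_zero _ (norm_codeApprox_lt_one _ _)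
    · exact (continuous_of_discreteTopology (f := fun d : Digit p n => (p : ℚ_[p]) ^ expo d)).comp
        h0
    · exact ((continuous_of_discreteTopology
        (f := fun d : Digit p n => (resid d : ℚ_[p]))).comp h0).add
        (ih.comp (continuous_pi fun i => continuous_apply (i + 1)))

lemma measurable_code : Measurable (code (p := p) (n := n)) :=
  measurable_of_tendsto_metrizable (fun m => (continuous_codeApprox m).measurable)
    (tendsto_pi_nhds.mpr tendsto_codeApprox)

end Coding

/-! ### Every point outside `F` is coded by its digit itinerary -/

section Itinerary

variable {p n : ℕ} [Fact p.Prime]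

lemma ne_zero_of_mem {x : ℚ_[p]} (hx : x ∈ pZpBounded p n \ F p) : x ≠ 0 :=
  fun h => hx.2 ⟨hx.1.1, 0, h⟩

lemma one_le_a₁ {x : ℚ_[p]} (hx : x ≠ 0) (h : ‖x‖ < 1) : 1 ≤ a₁ x := by
  rw [Padic.norm_eq_zpow_neg_valuation hx, ← zpow_zero (p : ℝ),
    zpow_lt_zpow_iff_right₀ one_lt_prime_cast] at h
  rw [a₁]
  omega

/-- The first digit of a point of `pℤ_{p,n} ∖ F`. -/
def digit (x : ↥(pZpBounded p n \ F p)) : Digit p n :=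
  (⟨(a₁ (x : ℚ_[p])).toNat - 1, by
    have h1 := one_le_a₁ (ne_zero_of_mem x.2) x.2.1.1
    have h2 := x.2.1.2 0
    rw [Function.iterate_zero_apply] at h2
    omega⟩,
   ⟨b₁ (x : ℚ_[p]) - 1, by
    have h1 := (b₁_spec (ne_zero_of_mem x.2)).1
    rw [Finset.mem_Icc] at h1
    omega⟩)

lemma expo_digit (x : ↥(pZpBounded p n \ F p)) : (expo (digit x) : ℤ) = a₁ (x : ℚ_[p]) := by
  have h1 := one_le_a₁ (ne_zero_of_mem x.2) x.2.1.1
  simp only [expo, digit]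
  omega

lemma resid_digit (x : ↥(pZpBounded p n \ F p)) : resid (digit x) = b₁ (x : ℚ_[p]) := by
  have h1 := (b₁_spec (ne_zero_of_mem x.2)).1
  rw [Finset.mem_Icc] at h1
  simp only [resid, digit]
  omega

lemma branch_digit (x : ↥(pZpBounded p n \ F p)) :
    branch (digit x) (Tn p n x : ℚ_[p]) = x := by
  have hx := ne_zero_of_mem x.2
  have hp : (p : ℚ_[p]) ≠ 0 := by exact_mod_cast (Fact.out : p.Prime).ne_zero
  have hT : (Tn p n x : ℚ_[p]) = T (x : ℚ_[p]) := rfl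
  rw [branch, ← zpow_natCast, expo_digit, resid_digit, hT, T, if_neg hx, add_sub_cancel]
  field_simp

lemma norm_sub_codeApprox_digit_le (m : ℕ) (x : ↥(pZpBounded p n \ F p)) :
    ‖(x : ℚ_[p]) - codeApprox m fun i => digit ((Tn p n)^[i] x)‖ ≤ (1 / 2) ^ m := by
  induction m generalizing x with
  | zero => simpa [codeApprox] using x.2.1.1.le
  | succ m ih =>
    rw [codeApprox, Function.iterate_zero_apply]
    nth_rw 1 [← branch_digit x]
    rw [norm_branch_sub _ (Tn p n x).2.1.1 (norm_codeApprox_lt_one _ _), pow_succ']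
    exact mul_le_mul (pow_expo_inv_le_half _) (ih (Tn p n x)) (norm_nonneg _) (by norm_num)

lemma code_digit (x : ↥(pZpBounded p n \ F p)) :
    code (fun i => digit ((Tn p n)^[i] x)) = x := by
  refine tendsto_nhds_unique (tendsto_codeApprox _) ?_
  rw [tendsto_iff_norm_sub_tendsto_zero]
  refine squeeze_zero (fun _ => norm_nonneg _) (fun m => ?_)
    (tendsto_pow_atTop_nhds_zero_of_lt_one (r := (1 / 2 : ℝ)) (by norm_num) (by norm_num))
  rw [norm_sub_rev]
  exact norm_sub_codeApprox_digit_le m x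

/-- The coding map onto `pℤ_{p,n} ∖ F`. -/
def codeMem (ω : ℕ → Digit p n) : ↥(pZpBounded p n \ F p) := ⟨code ω, code_mem ω⟩

lemma measurable_codeMem : Measurable (codeMem (p := p) (n := n)) :=
  measurable_code.subtype_mk

lemma codeMem_digit (x : ↥(pZpBounded p n \ F p)) :
    codeMem (fun i => digit ((Tn p n)^[i] x)) = x := Subtype.ext (code_digit x)

lemma Tn_codeMem (ω : ℕ → Digit p n) : Tn p n (codeMem ω) = codeMem (shift ω) :=
  Subtype.ext (T_code ω)

lemma digit_codeMem (ω : ℕ → Digit p n) : digit (codeMem ω) = ω 0 :=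
  digit_ext (by exact_mod_cast (expo_digit (codeMem ω)).trans (a₁_code ω))
    ((resid_digit (codeMem ω)).trans (b₁_code ω))

lemma digit_iterate_codeMem (i : ℕ) (ω : ℕ → Digit p n) :
    digit ((Tn p n)^[i] (codeMem ω)) = ω i := by
  have := Function.Semiconj.iterate_right (f := codeMem (p := p) (n := n))
    (fun ω => (Tn_codeMem ω).symm) i ω
  rw [← this, digit_codeMem, shift_iterate]
  simp

lemma isLocallyConstant_digit : IsLocallyConstant (digit (p := p) (n := n)) := by
  rw [IsLocallyConstant.iff_eventually_eq]
  intro x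
  have hx : 0 < ‖(x : ℚ_[p])‖ := norm_pos_iff.mpr (ne_zero_of_mem x.2)
  filter_upwards [Metric.ball_mem_nhds x hx] with y hy
  have h : ‖(x : ℚ_[p]) - y‖ < ‖(x : ℚ_[p])‖ := by
    rw [← dist_eq_norm, dist_comm]
    exact hy
  obtain ⟨h1, h2⟩ := digits_eq_of_norm_sub_lt h
  exact digit_ext (by exact_mod_cast (expo_digit y).trans (h1.trans (expo_digit x).symm))
    ((resid_digit y).trans (h2.trans (resid_digit x).symm))

lemma continuous_digit : Continuous (digit (p := p) (n := n)) :=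
  isLocallyConstant_digit.continuous

lemma measurable_digit : Measurable (digit (p := p) (n := n)) := continuous_digit.measurable

lemma measurable_Tn : Measurable (Tn p n) := by
  refine Continuous.measurable (Continuous.subtype_mk ?_ _)
  -- The digits are locally constant and 0 is excluded, so in this form `T` is visibly continuous.
  have h : (fun x : ↥(pZpBounded p n \ F p) => T (x : ℚ_[p])) =
      fun x => (p : ℚ_[p]) ^ expo (digit x) / (x : ℚ_[p]) - resid (digit x) := by
    funext x
    rw [T, if_neg (ne_zero_of_mem x.2), resid_digit, ← expo_digit, zpow_natCast]
  refine (continuous_congr (congrFun h)).mpr (Continuous.sub (Continuous.div ?_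
    continuous_subtype_val fun x => ne_zero_of_mem x.2) ?_)
  · exact (continuous_of_discreteTopology (f := fun d : Digit p n => (p : ℚ_[p]) ^ expo d)).comp
      continuous_digit
  · exact (continuous_of_discreteTopology (f := fun d : Digit p n => (resid d : ℚ_[p]))).comp
      continuous_digit

end Itinerary

/-! ### Gibbs' inequality and cross entropy -/

section Gibbs

/-- Gibbs' inequality. -/
lemma sum_negMulLog_le_sum_mul_neg_log {ι : Type*} [Fintype ι] {q r : ι → ℝ}
    (hq : ∀ i, 0 ≤ q i) (hr : ∀ i, 0 < r i) (h : ∑ i, r i ≤ ∑ i, q i) :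
    ∑ i, Real.negMulLog (q i) ≤ ∑ i, q i * -Real.log (r i) := by
  -- This is `log x ≤ x - 1` at `x = r i / q i`; summation then needs only a comparison of total
  -- masses.
  have key : ∀ i, Real.negMulLog (q i) - q i * -Real.log (r i) ≤ r i - q i := by
    intro i
    rcases (hq i).eq_or_lt with h0 | h0
    · simp [← h0, (hr i).le]
    · have h1 := Real.log_le_sub_one_of_pos (div_pos (hr i) h0)
      rw [Real.log_div (hr i).ne' h0.ne'] at h1
      have h2 := mul_le_mul_of_nonneg_left h1 h0.le
      have h3 : q i * (r i / q i - 1) = r i - q i := by field_simp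
      rw [Real.negMulLog]
      linarith
  have := Finset.sum_le_sum fun i (_ : i ∈ Finset.univ) => key i
  rw [Finset.sum_sub_distrib, Finset.sum_sub_distrib] at this
  linarith

variable {X : Type*} [MeasurableSpace X] {μ : Measure X} [IsProbabilityMeasure μ]
  {V W : Type*} [Fintype V] [MeasurableSpace V] [MeasurableSingletonClass V]
  [Fintype W] [MeasurableSpace W] [MeasurableSingletonClass W]

lemma integrable_comp_of_fintype {v : X → V} (hv : Measurable v) (f : V → ℝ) :
    Integrable (fun x => f (v x)) μ :=
  have := Measure.isProbabilityMeasure_map (μ := μ) hv.aemeasurable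
  (Integrable.of_finite (f := f) (μ := μ.map v)).comp_measurable hv

lemma integral_comp_of_fintype {v : X → V} (hv : Measurable v) (f : V → ℝ) :
    ∫ x, f (v x) ∂μ = ∑ c, μ.real (v ⁻¹' {c}) * f c := by
  have := Measure.isProbabilityMeasure_map (μ := μ) hv.aemeasurable
  rw [← integral_map (φ := v) hv.aemeasurable (measurable_of_finite f).aestronglyMeasurable,
    integral_fintype Integrable.of_finite]
  refine Finset.sum_congr rfl fun c _ => ?_
  rw [map_measureReal_apply hv (measurableSet_singleton c), smul_eq_mul]

/-- The entropy of a finite partition is at most the cross entropy of any finer partition with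
respect to a positive subprobability. -/
lemma sum_negMulLog_le_integral {w : X → W} {v : X → V} (hw : Measurable w) (hv : Measurable v)
    {r : W → V → ℝ} (hr : ∀ c u, 0 < r c u) (h : ∑ c, ∑ u, r c u ≤ 1) :
    ∑ c, Real.negMulLog (μ.real (w ⁻¹' {c})) ≤ ∫ x, -Real.log (r (w x) (v x)) ∂μ := by
  have : Nonempty V := (nonempty_of_isProbabilityMeasure μ).map v
  have hpos : ∀ c, 0 < ∑ u, r c u := fun c =>
    Finset.sum_pos (fun u _ => hr c u) Finset.univ_nonempty
  have h1 : ∑ c, μ.real (w ⁻¹' {c}) = 1 := by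
    simpa using (integral_comp_of_fintype (μ := μ) hw fun _ => 1).symm
  calc ∑ c, Real.negMulLog (μ.real (w ⁻¹' {c}))
      ≤ ∑ c, μ.real (w ⁻¹' {c}) * -Real.log (∑ u, r c u) :=
        sum_negMulLog_le_sum_mul_neg_log (fun _ => measureReal_nonneg) hpos (by rwa [h1])
    _ = ∫ x, -Real.log (∑ u, r (w x) u) ∂μ :=
        (integral_comp_of_fintype hw fun c => -Real.log (∑ u, r c u)).symm
    _ ≤ ∫ x, -Real.log (r (w x) (v x)) ∂μ := by
        refine integral_mono (integrable_comp_of_fintype hw fun c => -Real.log (∑ u, r c u))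
          (integrable_comp_of_fintype (hw.prodMk hv) fun c => -Real.log (r c.1 c.2)) fun x => ?_
        exact neg_le_neg (Real.log_le_log (hr _ _)
          (Finset.single_le_sum (f := fun u => r (w x) u) (fun u _ => (hr _ u).le)
            (Finset.mem_univ (v x))))

end Gibbs

/-! ### Entropy of a map with a finite generator -/

section Generator

variable {X : Type*} [MeasurableSpace X] {T : X → X} {μ : Measure X}
  {D : Type*} [MeasurableSpace D] {ξ : X → D}

/-- The first `l` symbols of the itinerary of `x`. -/
def word (T : X → X) (ξ : X → D) (l : ℕ) (x : X) : Fin l → D := fun i => ξ (T^[i] x)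

lemma measurable_word (hT : Measurable T) (hξ : Measurable ξ) (l : ℕ) :
    Measurable (word T ξ l) :=
  measurable_pi_lambda _ fun i => hξ.comp (hT.iterate i)

lemma integral_comp_iterate (hT : MeasurePreserving T μ μ) {f : X → ℝ} (hf : Measurable f)
    (i : ℕ) : ∫ x, f (T^[i] x) ∂μ = ∫ x, f x ∂μ := by
  have h := hT.iterate i
  nth_rw 2 [← h.map_eq]
  rw [integral_map h.measurable.aemeasurable hf.aestronglyMeasurable]

lemma integrable_comp_iterate (hT : MeasurePreserving T μ μ) {f : X → ℝ} (hi : Integrable f μ)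
    (i : ℕ) : Integrable (fun x => f (T^[i] x)) μ :=
  (hT.iterate i).integrable_comp_of_integrable hi

lemma integral_sum_comp_iterate (hT : MeasurePreserving T μ μ) {f : X → ℝ} (hf : Measurable f)
    (hi : Integrable f μ) (m : ℕ) :
    ∫ x, ∑ i : Fin m, f (T^[i] x) ∂μ = m * ∫ x, f x ∂μ := by
  rw [integral_finsetSum _ fun (i : Fin m) _ => integrable_comp_iterate hT hi i]
  simp [integral_comp_iterate hT hf]

lemma sum_prod_eq_one {ι E : Type*} [Fintype ι] [DecidableEq ι] [Fintype E] {f : ι → E → ℝ}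
    (hf : ∀ i, ∑ d, f i d = 1) : ∑ w : ι → E, ∏ i, f i (w i) = 1 := by
  have := Finset.prod_univ_sum (fun _ : ι => (Finset.univ : Finset E)) f
  rw [Fintype.piFinset_univ] at this
  rw [← this]
  exact Finset.prod_eq_one fun i _ => hf i

/-- If the itinerary determines the point measurably, measurable sets are approximated by sets
depending on finitely many symbols. -/
lemma exists_word_set_approx [IsFiniteMeasure μ] (hT : Measurable T) (hξ : Measurable ξ) {Φ : (ℕ → D) → X}
    (hΦ : Measurable Φ) (hleft : ∀ x, Φ (fun i => ξ (T^[i] x)) = x) {s : Set X}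
    (hs : MeasurableSet s) {δ : ℝ} (hδ : 0 < δ) :
    ∃ l₀, ∀ l ≥ l₀, ∃ S : Set (Fin l → D), μ.real (symmDiff (word T ξ l ⁻¹' S) s) < δ := by
  let κ : X → ℕ → D := fun x i => ξ (T^[i] x)
  have hκ : Measurable κ := measurable_pi_lambda _ fun i => hξ.comp (hT.iterate i)
  -- Cylinders over finitely many coordinates form a ring generating the product σ-algebra. The
  -- approximation is made for the law of the itinerary and pulled back, where `Φ ∘ κ = id` returns
  -- `s` itself.
  obtain ⟨t, ht, htδ⟩ := exists_measure_symmDiff_lt_of_generateFrom_isSetRing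
    (μ := μ.map κ) (isSetRing_measurableCylinders (α := fun _ : ℕ => D))
    ⟨{Set.univ}, Set.countable_singleton _,
      Set.singleton_subset_iff.mpr (univ_mem_measurableCylinders _), by simp⟩
    generateFrom_measurableCylinders.symm (hΦ hs) (ENNReal.ofReal_pos.mpr hδ)
  obtain ⟨I, S₀, hS₀, rfl⟩ := (mem_measurableCylinders _).mp ht
  have hmeas : MeasurableSet (symmDiff (cylinder I S₀) (Φ ⁻¹' s)) :=
    (MeasurableSet.of_mem_measurableCylinders ht).symmDiff (hΦ hs)
  rw [Measure.map_apply hκ hmeas, Set.preimage_symmDiff, ← Set.preimage_comp] at htδ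
  have hid : Φ ∘ κ = id := funext hleft
  rw [hid, Set.preimage_id] at htδ
  refine ⟨I.sup id + 1, fun l hl => ?_⟩
  have hI : ∀ i ∈ I, i < l := fun i hi => by
    have : i ≤ I.sup id := Finset.le_sup (f := id) hi
    omega
  refine ⟨{w | (fun i : I => w ⟨i, hI i i.2⟩) ∈ S₀}, ?_⟩
  exact (ENNReal.toReal_lt_of_lt_ofReal htδ)

/-- Each of the `K` atoms is approximated up to `δ / K`. Off the symmetric differences exactly one
of the approximating sets contains the word, so the arbitrary choice in `R` matters only on the
exceptional set. -/
lemma exists_word_approx [IsProbabilityMeasure μ] (hT : Measurable T) (hξ : Measurable ξ) {Φ : (ℕ → D) → X}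
    (hΦ : Measurable Φ) (hleft : ∀ x, Φ (fun i => ξ (T^[i] x)) = x) {K : ℕ} {Q : X → Fin K}
    (hQ : Measurable Q) {δ : ℝ} (hδ : 0 < δ) :
    ∃ (l : ℕ) (R : (Fin l → D) → Fin K), μ.real {x | Q x ≠ R (word T ξ l x)} ≤ δ := by
  classical
  obtain ⟨x₀⟩ := nonempty_of_isProbabilityMeasure μ
  have hK : (0 : ℝ) < K := by
    have := (Q x₀).pos
    exact_mod_cast this
  choose l₀ hl₀ using fun j : Fin K =>
    exists_word_set_approx (μ := μ) hT hξ hΦ hleft (hQ (measurableSet_singleton j))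
      (div_pos hδ hK)
  let l := Finset.univ.sup l₀
  choose S hS using fun j : Fin K => hl₀ j l (Finset.le_sup (Finset.mem_univ j))
  let R : (Fin l → D) → Fin K := fun u => if h : ∃ j, u ∈ S j then h.choose else Q x₀
  refine ⟨l, R, ?_⟩
  have hsub : {x | Q x ≠ R (word T ξ l x)} ⊆
      ⋃ j, symmDiff (word T ξ l ⁻¹' S j) (Q ⁻¹' {j}) := by
    intro x hx
    by_contra hcon
    rw [Set.mem_iUnion, not_exists] at hcon
    have hiff : ∀ j, word T ξ l x ∈ S j ↔ Q x = j := fun j => by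
      have := hcon j
      simp only [Set.mem_symmDiff, Set.mem_preimage, Set.mem_singleton_iff] at this
      tauto
    have hex : ∃ j, word T ξ l x ∈ S j := ⟨Q x, (hiff _).mpr rfl⟩
    refine hx ?_
    simp only [R, dif_pos hex]
    exact (hiff _).mp hex.choose_spec
  calc μ.real {x | Q x ≠ R (word T ξ l x)}
      ≤ μ.real (⋃ j, symmDiff (word T ξ l ⁻¹' S j) (Q ⁻¹' {j})) := measureReal_mono hsub
    _ ≤ ∑ j, μ.real (symmDiff (word T ξ l ⁻¹' S j) (Q ⁻¹' {j})) := measureReal_iUnion_fintype_le _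
    _ ≤ ∑ _j : Fin K, δ / K := Finset.sum_le_sum fun j _ => (hS j).le
    _ = δ := by
      rw [Finset.sum_const, Finset.card_univ, Fintype.card_fin, nsmul_eq_mul]
      field_simp

variable [IsProbabilityMeasure μ] [Fintype D] [MeasurableSingletonClass D]

/-- The entropy of `Q ∨ ⋯ ∨ T^{-(m-1)} Q` is controlled by any positive weights on the symbols
of the itinerary together with any positive conditional weights of `Q` given a window of `l`
symbols. -/
lemma joinEntropy_le (hT : MeasurePreserving T μ μ) (hξ : Measurable ξ) {π : D → ℝ}
    (hπ : ∀ d, 0 < π d) (hπ1 : ∑ d, π d = 1) {K l : ℕ} {Q : X → Fin K} (hQ : Measurable Q)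
    {θ : Fin K → (Fin l → D) → ℝ} (hθ : ∀ j u, 0 < θ j u) (hθ1 : ∀ u, ∑ j, θ j u = 1) (m : ℕ) :
    joinEntropy T μ Q m ≤ (m + l) * ∫ x, -Real.log (π (ξ x)) ∂μ +
      m * ∫ x, -Real.log (θ (Q x) (word T ξ l x)) ∂μ := by
  classical
  let win : (Fin (m + l) → D) → Fin m → Fin l → D :=
    fun v i j => v ⟨i + j, by have := i.2; have := j.2; omega⟩
  -- Joint weights: independent symbols, then each label given its window of `l` symbols. Words of
  -- length `m + l` contain all `m` windows, and summing out the labels first shows that the total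
  -- mass is 1.
  let r : (Fin m → Fin K) → (Fin (m + l) → D) → ℝ :=
    fun w v => (∏ i, π (v i)) * ∏ i, θ (w i) (win v i)
  have hr : ∀ w v, 0 < r w v := fun w v =>
    mul_pos (Finset.prod_pos fun i _ => hπ _) (Finset.prod_pos fun i _ => hθ _ _)
  have hr1 : ∑ w, ∑ v, r w v ≤ 1 := by
    rw [Finset.sum_comm]
    have : ∀ v, ∑ w, r w v = ∏ i, π (v i) := fun v => by
      rw [← Finset.mul_sum, sum_prod_eq_one (f := fun i j => θ j (win v i)) fun i => hθ1 _,
        mul_one]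
    rw [Finset.sum_congr rfl fun v _ => this v, sum_prod_eq_one fun _ => hπ1]
  have hw : Measurable fun x => fun i : Fin m => Q (T^[i] x) :=
    measurable_pi_lambda _ fun i => hQ.comp (hT.measurable.iterate i)
  have key := sum_negMulLog_le_integral (μ := μ) hw (measurable_word hT.measurable hξ (m + l))
    hr hr1
  have hset : ∀ w : Fin m → Fin K, (fun x => fun i : Fin m => Q (T^[i] x)) ⁻¹' {w} =
      {x | ∀ i : Fin m, Q (T^[i] x) = w i} := fun w => by
    ext x; simp [funext_iff]
  simp only [hset] at key
  refine key.trans_eq ?_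
  have hwin : ∀ x i, win (word T ξ (m + l) x) i = word T ξ l (T^[i] x) := fun x i => by
    funext j
    simp only [win, word, ← Function.iterate_add_apply, add_comm]
  have hlog : ∀ x, -Real.log (r (fun i => Q (T^[i] x)) (word T ξ (m + l) x)) =
      ∑ i : Fin (m + l), -Real.log (π (ξ (T^[i] x))) +
        ∑ i : Fin m, -Real.log (θ (Q (T^[i] x)) (word T ξ l (T^[i] x))) := fun x => by
    simp only [r]
    rw [Real.log_mul (Finset.prod_pos fun i _ => hπ _).ne'
      (Finset.prod_pos fun i _ => hθ _ _).ne', Real.log_prod fun i _ => (hπ _).ne',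
      Real.log_prod fun i _ => (hθ _ _).ne', neg_add, ← Finset.sum_neg_distrib,
      ← Finset.sum_neg_distrib]
    simp only [hwin]
    rfl
  simp only [hlog]
  have hQw := hQ.prodMk (measurable_word hT.measurable hξ l)
  have i1 : Integrable (fun x => -Real.log (π (ξ x))) μ :=
    integrable_comp_of_fintype hξ fun d => -Real.log (π d)
  have i2 : Integrable (fun x => -Real.log (θ (Q x) (word T ξ l x))) μ :=
    integrable_comp_of_fintype hQw fun c => -Real.log (θ c.1 c.2)
  have m1 : Measurable fun x => -Real.log (π (ξ x)) :=
    (measurable_of_finite fun d => -Real.log (π d)).comp hξ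
  have m2 : Measurable fun x => -Real.log (θ (Q x) (word T ξ l x)) :=
    (measurable_of_finite fun c : Fin K × (Fin l → D) => -Real.log (θ c.1 c.2)).comp hQw
  rw [integral_add
    (integrable_finsetSum _ fun (i : Fin (m + l)) _ => integrable_comp_iterate hT i1 i)
    (integrable_finsetSum _ fun (i : Fin m) _ => integrable_comp_iterate hT i2 i),
    integral_sum_comp_iterate hT m1 i1, integral_sum_comp_iterate hT m2 i2]
  push_cast
  rfl

/-- Conditional weights concentrated near the graph of `R`. -/
lemma exists_conditional_weights {K l : ℕ} {Q : X → Fin K} (hQ : Measurable Q)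
    (hT : Measurable T) (hξ : Measurable ξ) (R : (Fin l → D) → Fin K) {ε : ℝ} (hε : 0 < ε)
    (hε1 : ε < 1) :
    ∃ θ : Fin K → (Fin l → D) → ℝ, (∀ j u, 0 < θ j u) ∧ (∀ u, ∑ j, θ j u = 1) ∧
      ∫ x, -Real.log (θ (Q x) (word T ξ l x)) ∂μ ≤
        -Real.log (1 - ε) + μ.real {x | Q x ≠ R (word T ξ l x)} * Real.log (K / ε) := by
  classical
  obtain ⟨x₀⟩ := nonempty_of_isProbabilityMeasure μ
  have hK : (1 : ℝ) ≤ K := by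
    have := (Q x₀).pos
    exact_mod_cast this
  have hK0 : (0 : ℝ) < K := zero_lt_one.trans_le hK
  have hεK : 0 < ε / K := div_pos hε hK0
  -- A correct prediction by `R` costs at most `-log (1 - ε)` and a wrong one exactly `log (K / ε)`.
  let θ : Fin K → (Fin l → D) → ℝ := fun j u => (if j = R u then 1 - ε else 0) + ε / K
  have hθ : ∀ j u, 0 < θ j u := fun j u => by
    simp only [θ]
    split_ifs <;> linarith
  refine ⟨θ, hθ, fun u => ?_, ?_⟩
  · simp only [θ, Finset.sum_add_distrib, Finset.sum_ite_eq', Finset.mem_univ, if_true,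
      Finset.sum_const, Finset.card_univ, Fintype.card_fin, nsmul_eq_mul]
    field_simp
    ring
  have hQw := hQ.prodMk (measurable_word hT hξ l)
  let S : Set X := {x | Q x ≠ R (word T ξ l x)}
  have hS : MeasurableSet S :=
    (measurableSet_eq_fun hQ ((measurable_of_finite R).comp (measurable_word hT hξ l))).compl
  have hlog : 0 ≤ -Real.log (1 - ε) := by
    have := Real.log_nonpos (x := 1 - ε) (by linarith) (by linarith)
    linarith
  calc ∫ x, -Real.log (θ (Q x) (word T ξ l x)) ∂μ
      ≤ ∫ x, (-Real.log (1 - ε) + S.indicator (fun _ => Real.log (K / ε)) x) ∂μ := by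
        refine integral_mono (integrable_comp_of_fintype hQw fun c => -Real.log (θ c.1 c.2))
          ((integrable_const _).add ((integrable_const _).indicator hS)) fun x => ?_
        by_cases hx : Q x = R (word T ξ l x)
        · have : x ∉ S := fun h => h hx
          simp only [θ, if_pos hx, Set.indicator_of_notMem this, add_zero]
          exact neg_le_neg (Real.log_le_log (by linarith) (by linarith))
        · simp only [θ, if_neg hx, Set.indicator_of_mem (show x ∈ S from hx), zero_add]
          rw [← Real.log_inv, inv_div]
          linarith
    _ = _ := by
        rw [integral_add (integrable_const _) ((integrable_const _).indicator hS),
          integral_indicator_const _ hS]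
        simp [S]

/-- The entropy of a map with a finite generator is at most the cross entropy of the generator
with respect to any positive probability vector. -/
lemma entropy_le_integral (hT : MeasurePreserving T μ μ) (hξ : Measurable ξ)
    {Φ : (ℕ → D) → X} (hΦ : Measurable Φ) (hleft : ∀ x, Φ (fun i => ξ (T^[i] x)) = x)
    {π : D → ℝ} (hπ : ∀ d, 0 < π d) (hπ1 : ∑ d, π d = 1) :
    entropy T μ ≤ ((∫ x, -Real.log (π (ξ x)) ∂μ : ℝ) : EReal) := by
  refine iSup_le fun K => iSup_le fun Q => iSup_le fun hQ => ?_
  set c := ∫ x, -Real.log (π (ξ x)) ∂μ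
  rw [← EReal.le_of_forall_lt_iff_le]
  intro z hz
  rw [EReal.coe_lt_coe_iff] at hz
  -- The margin `z - c` is split in two halves: `ε` makes the cost of correct predictions equal to
  -- `η`, and the error probability below keeps the cost of wrong ones at most `η`.
  set η := (z - c) / 2 with hη
  have hη0 : 0 < η := by rw [hη]; linarith
  set ε := 1 - Real.exp (-η) with hε
  have hε0 : 0 < ε := by
    have := Real.exp_lt_one_iff.mpr (neg_lt_zero.mpr hη0)
    linarith
  have hε1 : ε < 1 := by
    have := Real.exp_pos (-η)
    linarith
  have hlogε : -Real.log (1 - ε) = η := by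
    rw [hε, sub_sub_cancel, Real.log_exp, neg_neg]
  obtain ⟨x₀⟩ := nonempty_of_isProbabilityMeasure μ
  have hK : (1 : ℝ) ≤ K := by
    have := (Q x₀).pos
    exact_mod_cast this
  have hL : 0 ≤ Real.log (K / ε) := Real.log_nonneg (by rw [one_le_div hε0]; linarith)
  have hL1 : 0 < Real.log (K / ε) + 1 := by linarith
  obtain ⟨l, R, hR⟩ := exists_word_approx (μ := μ) hT.measurable hξ hΦ hleft hQ (div_pos hη0 hL1)
  obtain ⟨θ, hθ, hθ1, hθe⟩ :=
    exists_conditional_weights (μ := μ) hQ hT.measurable hξ R hε0 hε1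
  have he : ∫ x, -Real.log (θ (Q x) (word T ξ l x)) ∂μ ≤ z - c := by
    have h1 := mul_le_mul_of_nonneg_right hR hL
    have h2 : η / (Real.log (K / ε) + 1) * Real.log (K / ε) ≤ η := by
      rw [div_mul_eq_mul_div, div_le_iff₀ hL1]
      nlinarith
    linarith
  -- The `l` symbols beyond the first `m` cost `l * c` in all, which disappears after division by
  -- `m`.
  have hlim : Tendsto (fun m : ℕ => ((z + l * c * (1 / (m : ℝ)) : ℝ) : EReal)) atTop
      (𝓝 (z : EReal)) := by
    rw [EReal.tendsto_coe]
    simpa using tendsto_const_nhds.add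
      ((tendsto_one_div_atTop_nhds_zero_nat (𝕜 := ℝ)).const_mul (l * c))
  rw [partitionEntropy, ← hlim.limsup_eq]
  refine limsup_le_limsup ?_
  filter_upwards [eventually_gt_atTop 0] with m hm
  have hm' : (0 : ℝ) < m := by exact_mod_cast hm
  rw [EReal.coe_le_coe_iff, div_le_iff₀ hm']
  refine (joinEntropy_le hT hξ hπ hπ1 hQ hθ hθ1 m).trans ?_
  have h1 := mul_le_mul_of_nonneg_left he hm'.le
  have h2 : (z + l * c * (1 / (m : ℝ))) * m = (m + l) * c + m * (z - c) := by
    field_simp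
    ring
  rw [h2]
  linarith

/-- The entropy of a Bernoulli measure is at least the entropy of its probability vector. -/
lemma integral_le_entropy_of_bernoulli (hT : MeasurePreserving T μ μ) (hξ : Measurable ξ)
    {π : D → ℝ} (hπ : ∀ d, 0 < π d)
    (hμ : ∀ (m : ℕ) (w : Fin m → D), μ.real {x | ∀ i : Fin m, ξ (T^[i] x) = w i} = ∏ i, π (w i)) :
    ((∫ x, -Real.log (π (ξ x)) ∂μ : ℝ) : EReal) ≤ entropy T μ := by
  classical
  let e := Fintype.equivFin D
  have hQ : Measurable fun x => e (ξ x) := (measurable_of_finite e).comp hξ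
  refine le_trans (le_of_eq ?_) (le_iSup_of_le _ (le_iSup_of_le _ (le_iSup_of_le hQ le_rfl)))
  have hm1 : Measurable fun x => -Real.log (π (ξ x)) :=
    (measurable_of_finite fun d => -Real.log (π d)).comp hξ
  have hi1 : Integrable (fun x => -Real.log (π (ξ x))) μ :=
    integrable_comp_of_fintype hξ fun d => -Real.log (π d)
  have hjoin : ∀ m : ℕ, joinEntropy T μ (fun x => e (ξ x)) m =
      m * ∫ x, -Real.log (π (ξ x)) ∂μ := fun m => by
    have hw : Measurable fun x => fun i : Fin m => e (ξ (T^[i] x)) :=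
      measurable_pi_lambda _ fun i => hQ.comp (hT.measurable.iterate i)
    have hset : ∀ w : Fin m → Fin (Fintype.card D),
        (fun x => fun i : Fin m => e (ξ (T^[i] x))) ⁻¹' {w} =
          {x | ∀ i : Fin m, ξ (T^[i] x) = e.symm (w i)} := fun w => by
      ext x; simp [funext_iff, Equiv.eq_symm_apply]
    have h1 := integral_comp_of_fintype (μ := μ) hw
      fun w => -Real.log (∏ i, π (e.symm (w i)))
    have h2 : ∀ x, -Real.log (∏ i : Fin m, π (e.symm (e (ξ (T^[i] x))))) =
        ∑ i : Fin m, -Real.log (π (ξ (T^[i] x))) := fun x => by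
      simp only [Equiv.symm_apply_apply]
      rw [Real.log_prod fun i _ => (hπ _).ne', ← Finset.sum_neg_distrib]
    simp only [h2, hset, hμ] at h1
    rw [integral_sum_comp_iterate hT hm1 hi1] at h1
    rw [h1, joinEntropy]
    refine Finset.sum_congr rfl fun w _ => ?_
    have : {x | ∀ i : Fin m, e (ξ (T^[i] x)) = w i} =
        {x | ∀ i : Fin m, ξ (T^[i] x) = e.symm (w i)} := by
      ext x; simp [Equiv.eq_symm_apply]
    rw [this, hμ, Real.negMulLog]
    ring
  have hlim : Tendsto (fun m : ℕ => ((joinEntropy T μ (fun x => e (ξ x)) m / m : ℝ) : EReal)) atTop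
      (𝓝 ((∫ x, -Real.log (π (ξ x)) ∂μ : ℝ) : EReal)) := by
    refine tendsto_const_nhds.congr' ?_
    filter_upwards [eventually_gt_atTop 0] with m hm
    have hm' : (m : ℝ) ≠ 0 := by exact_mod_cast hm.ne'
    rw [hjoin, mul_div_cancel_left₀ _ hm']
  exact hlim.limsup_eq.symm

end Generator

/-! ### Variational principle for a one-symbol potential -/

section Pressure

variable {X : Type*} [MeasurableSpace X] {T : X → X}
  {D : Type*} [Fintype D] [Nonempty D] [MeasurableSpace D] [MeasurableSingletonClass D] {ξ : X → D}

/-- The variational principle for a full shift and a potential depending on the first symbol. -/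
theorem pressure_eq_log_sum_exp (hξ : Measurable ξ)
    {Φ : (ℕ → D) → X} (hΦ : Measurable Φ) (hleft : ∀ x, Φ (fun i => ξ (T^[i] x)) = x)
    (hB : ∀ π : D → ℝ, (∀ d, 0 < π d) → ∑ d, π d = 1 →
      ∃ μ : Measure X, IsProbabilityMeasure μ ∧ MeasurePreserving T μ μ ∧
        ∀ (m : ℕ) (w : Fin m → D),
          μ.real {x | ∀ i : Fin m, ξ (T^[i] x) = w i} = ∏ i, π (w i))
    (g : D → ℝ) :
    pressure T (fun x => g (ξ x)) = ((Real.log (∑ d, Real.exp (g d)) : ℝ) : EReal) := by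
  set Z := ∑ d, Real.exp (g d) with hZ
  have hZ0 : 0 < Z := Finset.sum_pos (fun d _ => Real.exp_pos _) Finset.univ_nonempty
  -- With these weights the cross entropy plus `∫ g` is `log Z` for every probability measure, so
  -- `log Z` bounds the pressure; the Bernoulli measure gives the reverse inequality.
  let π : D → ℝ := fun d => Real.exp (g d) / Z
  have hπ : ∀ d, 0 < π d := fun d => div_pos (Real.exp_pos _) hZ0
  have hπ1 : ∑ d, π d = 1 := by
    rw [← Finset.sum_div, div_self hZ0.ne']
  have hlog : ∀ d, -Real.log (π d) = Real.log Z - g d := fun d => by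
    rw [Real.log_div (Real.exp_pos _).ne' hZ0.ne', Real.log_exp, neg_sub]
  have hint : ∀ μ : Measure X, IsProbabilityMeasure μ →
      ∫ x, -Real.log (π (ξ x)) ∂μ = Real.log Z - ∫ x, g (ξ x) ∂μ := fun μ _ => by
    simp only [hlog]
    rw [integral_sub (integrable_const _) (integrable_comp_of_fintype hξ g)]
    simp
  refine le_antisymm ?_ ?_
  · refine iSup_le fun μ => iSup_le fun hμ => iSup_le fun hT => iSup_le fun _ => ?_
    have h := entropy_le_integral hT hξ hΦ hleft hπ hπ1
    rw [hint μ hμ] at h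
    refine (add_le_add_left h _).trans_eq ?_
    rw [← EReal.coe_add, sub_add_cancel]
  · obtain ⟨μ, hμ, hT, hcyl⟩ := hB π hπ hπ1
    refine le_iSup_of_le μ (le_iSup_of_le hμ (le_iSup_of_le hT
      (le_iSup_of_le (integrable_comp_of_fintype hξ g) ?_)))
    have h := integral_le_entropy_of_bernoulli hT hξ hπ hcyl
    rw [hint μ hμ] at h
    refine le_trans (le_of_eq ?_) (add_le_add_left h _)
    rw [← EReal.coe_add, sub_add_cancel]

end Pressure

/-! ### Bernoulli measures on digit sequences -/

section Bernoulli

variable {D : Type*} [MeasurableSpace D]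

lemma exists_measure_real_singleton [Fintype D] [MeasurableSingletonClass D] {π : D → ℝ} (hπ : ∀ d, 0 ≤ π d)
    (hπ1 : ∑ d, π d = 1) :
    ∃ ν : Measure D, IsProbabilityMeasure ν ∧ ∀ d, ν.real {d} = π d := by
  classical
  refine ⟨∑ d, ENNReal.ofReal (π d) • Measure.dirac d, ⟨?_⟩, fun d => ?_⟩
  · simp only [Measure.finsetSum_apply, Measure.smul_apply, measure_univ, smul_eq_mul, mul_one]
    rw [← ENNReal.ofReal_sum_of_nonneg fun d _ => hπ d, hπ1, ENNReal.ofReal_one]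
  · have h : (∑ d, ENNReal.ofReal (π d) • Measure.dirac d) {d} = ENNReal.ofReal (π d) := by
      simp only [Measure.finsetSum_apply, Measure.smul_apply,
        Measure.dirac_apply' _ (measurableSet_singleton d), smul_eq_mul]
      rw [Finset.sum_eq_single d]
      · simp
      · intro b _ hb
        simp [hb]
      · simp
    rw [measureReal_def, h, ENNReal.toReal_ofReal (hπ d)]

/-- The Bernoulli measure on sequences whose symbols are independent of law `ν`. -/
def bernoulli (ν : Measure D) : Measure (ℕ → D) := Measure.infinitePi fun _ => ν

variable (ν : Measure D) [IsProbabilityMeasure ν]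

instance : IsProbabilityMeasure (bernoulli ν) :=
  inferInstanceAs (IsProbabilityMeasure (Measure.infinitePi fun _ : ℕ => ν))

lemma measurePreserving_shift : MeasurePreserving (shift (D := D)) (bernoulli ν) (bernoulli ν) :=
  ⟨measurable_pi_lambda _ fun i => measurable_pi_apply (i + 1),
    Measure.map_infinitePi_infinitePi_of_inj (P := fun _ : ℕ => ν) (add_left_injective 1)⟩

variable [MeasurableSingletonClass D]

lemma bernoulli_real_cylinder (m : ℕ) (w : ℕ → D) :
    (bernoulli ν).real {ω | ∀ i < m, ω i = w i} = ∏ i ∈ Finset.range m, ν.real {w i} := by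
  have h : {ω : ℕ → D | ∀ i < m, ω i = w i} =
      Set.pi (Finset.range m : Set ℕ) fun i => {w i} := by
    ext ω; simp [Set.mem_pi]
  rw [h, measureReal_def, bernoulli,
    Measure.infinitePi_pi _ fun i _ => measurableSet_singleton (w i), ENNReal.toReal_prod]
  rfl

lemma bernoulli_real_cylinder_fin (m : ℕ) (w : Fin m → D) :
    (bernoulli ν).real {ω | ∀ i : Fin m, ω i = w i} = ∏ i, ν.real {w i} := by
  obtain ⟨d⟩ := nonempty_of_isProbabilityMeasure ν
  have h := bernoulli_real_cylinder ν m fun i => if h : i < m then w ⟨i, h⟩ else d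
  rw [← Fin.prod_univ_eq_prod_range
    (fun i => ν.real {if h : i < m then w ⟨i, h⟩ else d})] at h
  have hset : {ω : ℕ → D | ∀ i : Fin m, ω i = w i} =
      {ω | ∀ i < m, ω i = if h : i < m then w ⟨i, h⟩ else d} := by
    ext ω
    refine ⟨fun h i hi => ?_, fun h i => ?_⟩
    · rw [dif_pos hi]; exact h ⟨i, hi⟩
    · have := h i i.2
      rwa [dif_pos i.2] at this
  rw [hset, h]
  simp

/-- The law of large numbers for Bernoulli measures. -/
lemma ae_tendsto_average [Fintype D] (f : D → ℝ) :
    ∀ᵐ ω ∂bernoulli ν, Tendsto (fun m : ℕ => (∑ i ∈ Finset.range m, f (ω i)) / m) atTop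
      (𝓝 (∑ d, ν.real {d} * f d)) := by
  have hf : Measurable f := measurable_of_finite f
  have heval : ∀ i : ℕ, (bernoulli ν).map (fun ω => ω i) = ν :=
    fun i => Measure.infinitePi_map_eval (fun _ : ℕ => ν) i
  have hm : ∀ i : ℕ, Measurable fun ω : ℕ → D => f (ω i) :=
    fun i => hf.comp (measurable_pi_apply i)
  have hmap : ∀ i : ℕ, (bernoulli ν).map (fun ω => f (ω i)) = ν.map f := fun i =>
    (Measure.map_map hf (measurable_pi_apply i)).symm.trans (by rw [heval])
  have h := ProbabilityTheory.strong_law_ae_real (μ := bernoulli ν) (fun i ω => f (ω i))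
    (integrable_comp_of_fintype (v := fun ω : ℕ → D => ω 0) (measurable_pi_apply 0) f)
    (fun i j hij => (ProbabilityTheory.iIndepFun_infinitePi (P := fun _ : ℕ => ν)
      (X := fun _ => f) fun _ => hf).indepFun hij)
    fun i => ⟨(hm i).aemeasurable, (hm 0).aemeasurable, by rw [hmap, hmap]⟩
  have h2 : ∫ ω, f (ω 0) ∂bernoulli ν = ∑ d, ν.real {d} * f d := by
    rw [integral_comp_of_fintype (v := fun ω : ℕ → D => ω 0) (measurable_pi_apply 0) f]
    refine Finset.sum_congr rfl fun d _ => ?_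
    rw [← map_measureReal_apply (measurable_pi_apply 0) (measurableSet_singleton d), heval]
  rw [← h2]
  exact h

end Bernoulli

/-! ### The pressure of the Schneider map -/

section Pressure

variable {p n : ℕ} [Fact p.Prime]

/-- The partition function `∑_{a, b} p^{-ta}`, so that the pressure of `-t log ψ` is its
logarithm. -/
def partitionSum (p n : ℕ) (t : ℝ) : ℝ := ∑ d : Digit p n, Real.exp (-t * (expo d * Real.log p))

lemma nonempty_digit (hn : 1 ≤ n) : Nonempty (Digit p n) :=
  ⟨(⟨0, hn⟩, ⟨0, Nat.sub_pos_of_lt (Fact.out : p.Prime).one_lt⟩)⟩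

lemma partitionSum_pos (hn : 1 ≤ n) (t : ℝ) : 0 < partitionSum p n t :=
  have := nonempty_digit (p := p) hn
  Finset.sum_pos (fun _ _ => Real.exp_pos _) Finset.univ_nonempty

/-- The coding map carries the shift to `Tn` and turns coordinates into digits, so a Bernoulli
measure on sequences can be pushed forward. -/
lemma exists_bernoulli_measure {π : Digit p n → ℝ} (hπ : ∀ d, 0 < π d) (hπ1 : ∑ d, π d = 1) :
    ∃ μ : Measure ↥(pZpBounded p n \ F p), IsProbabilityMeasure μ ∧
      MeasurePreserving (Tn p n) μ μ ∧ ∀ (m : ℕ) (w : Fin m → Digit p n),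
        μ.real {x | ∀ i : Fin m, digit ((Tn p n)^[i] x) = w i} = ∏ i, π (w i) := by
  obtain ⟨ν, hν, hνπ⟩ := exists_measure_real_singleton (fun d => (hπ d).le) hπ1
  refine ⟨(bernoulli ν).map codeMem,
    Measure.isProbabilityMeasure_map measurable_codeMem.aemeasurable, ⟨measurable_Tn, ?_⟩, ?_⟩
  · have h : Tn p n ∘ codeMem = codeMem ∘ shift := funext Tn_codeMem
    have hs := measurePreserving_shift ν
    rw [Measure.map_map measurable_Tn measurable_codeMem, h,
      ← Measure.map_map measurable_codeMem hs.measurable, hs.map_eq]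
  · intro m w
    have hmeas : MeasurableSet {x | ∀ i : Fin m, digit ((Tn p n)^[i] x) = w i} := by
      rw [Set.ofPred_forall]
      exact MeasurableSet.iInter fun i =>
        (measurable_digit.comp (measurable_Tn.iterate i)) (measurableSet_singleton (w i))
    rw [map_measureReal_apply measurable_codeMem hmeas]
    simp only [Set.preimage_ofPred_eq, digit_iterate_codeMem]
    rw [bernoulli_real_cylinder_fin]
    simp [hνπ]

theorem Pn_eq (hn : 1 ≤ n) (t : ℝ) : Pn p n t = ((Real.log (partitionSum p n t) : ℝ) : EReal) := by
  have := nonempty_digit (p := p) hn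
  have h : (fun x : ↥(pZpBounded p n \ F p) => -t * Real.log (ψ (x : ℚ_[p]))) =
      fun x => -t * (expo (digit x) * Real.log p) := by
    funext x
    rw [ψ, ← expo_digit, zpow_natCast, Real.log_pow]
  rw [Pn, h]
  exact pressure_eq_log_sum_exp (T := Tn p n) (ξ := digit) measurable_digit measurable_codeMem
    codeMem_digit (fun π hπ hπ1 => exists_bernoulli_measure hπ hπ1)
    fun d => -t * (expo d * Real.log p)

end Pressure

/-! ### Upper and lower bounds for the Hausdorff dimension -/

section Dimension

open scoped ENNReal NNReal

variable {p n : ℕ} [Fact p.Prime]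

lemma exists_code_eq {x : ℚ_[p]} (hx : x ∈ pZpBounded p n \ F p) :
    ∃ ω : ℕ → Digit p n, code ω = x := ⟨_, code_digit ⟨x, hx⟩⟩

/-- The error of the `m`-th convergent involves one digit more than the average; that digit
contributes at most `n log p / m`. -/
lemma code_mem_approxSet_iff (ω : ℕ → Digit p n) (α : ℝ) :
    code ω ∈ approxSet p n α ↔
      Tendsto (fun m : ℕ => (expoSum m ω : ℝ) * Real.log p / m) atTop (𝓝 α) := by
  have h1 : ∀ m : ℕ, -(1 / (m : ℝ) * Real.log ‖code ω - convergent m (code ω)‖) =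
      (expoSum m ω : ℝ) * Real.log p / m + expo (ω m) * Real.log p / m := fun m => by
    rw [convergent_code, norm_code_sub_codeApprox, Real.log_inv, Real.log_pow, expoSum_succ]
    push_cast
    ring
  have h2 : Tendsto (fun m : ℕ => (expo (ω m) : ℝ) * Real.log p / m) atTop (𝓝 0) := by
    refine squeeze_zero (fun m => ?_) (fun m => ?_)
      (tendsto_const_div_atTop_nhds_zero_nat ((n : ℝ) * Real.log p))
    · exact div_nonneg (mul_nonneg (Nat.cast_nonneg _) log_prime_pos.le) (Nat.cast_nonneg _)
    · refine div_le_div_of_nonneg_right (mul_le_mul_of_nonneg_right ?_ log_prime_pos.le)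
        (Nat.cast_nonneg _)
      exact_mod_cast expo_le _
  have h3 : code ω ∈ approxSet p n α ↔ Tendsto (fun m : ℕ =>
      (expoSum m ω : ℝ) * Real.log p / m + expo (ω m) * Real.log p / m) atTop (𝓝 α) := by
    rw [approxSet, Set.mem_ofPred_eq, and_iff_right (code_mem ω)]
    simp only [h1]
  rw [h3]
  refine ⟨fun h => ?_, fun h => ?_⟩
  · simpa using h.sub h2
  · simpa using h.add h2

lemma inv_pow_expoSum_eq_exp (m : ℕ) (ω : ℕ → Digit p n) :
    ((p : ℝ) ^ expoSum m ω)⁻¹ = Real.exp (-(expoSum m ω * Real.log p)) := by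
  rw [Real.exp_neg, ← Real.log_pow, Real.exp_log (pow_pos prime_cast_pos _)]

/-- The dimension of `approxSet p n α` is bounded by covering with the cylinders of rank `m`,
weighted by the Gibbs weights of parameter `t`. -/
theorem dimH_approxSet_le (hn : 1 ≤ n) {α : ℝ} (hα : 0 < α) (t : ℝ) :
    dimH (approxSet p n α) ≤ ENNReal.ofReal (1 / α * Real.log (partitionSum p n t) + t) := by
  classical
  set L := Real.log (partitionSum p n t) with hL
  have hlp := log_prime_pos (p := p)
  refine le_of_forall_gt_imp_ge_of_dense fun a ha => ?_
  induction a using ENNReal.recTopCoe with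
  | top => exact le_top
  | coe s =>
  have hs0 : (0 : ℝ) < s := by
    have : (0 : ℝ≥0∞) < s := zero_le.trans_lt ha
    exact_mod_cast this
  have hs : 1 / α * L + t < s := by
    rw [← ENNReal.ofReal_coe_nnreal, ENNReal.ofReal_lt_ofReal_iff hs0] at ha
    exact ha
  have hsL : L < (s - t) * α := by
    have : 1 / α * L < s - t := by linarith
    rwa [one_div, inv_mul_lt_iff₀ hα, mul_comm] at this
  -- As `L < (s - t) α` is strict, the inequality holds eventually along each admissible sequence.
  -- Fixing the threshold `N` makes it uniform, and dimension is countably stable.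
  let Ω : ℕ → Set (ℕ → Digit p n) := fun N =>
    {ω | ∀ m ≥ N, m * L ≤ (s - t) * (expoSum m ω * Real.log p)}
  have hcover : approxSet p n α ⊆ ⋃ N, code '' Ω N := by
    intro x hx
    obtain ⟨ω, rfl⟩ := exists_code_eq hx.1
    have h1 := ((code_mem_approxSet_iff ω α).mp hx).const_mul ((s : ℝ) - t)
    obtain ⟨N, hN⟩ := eventually_atTop.mp ((h1.eventually_const_lt hsL).and
      (eventually_gt_atTop 0))
    refine Set.mem_iUnion.mpr ⟨N, ω, fun m hm => ?_, rfl⟩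
    obtain ⟨h2, h3⟩ := hN m hm
    have h3' : (0 : ℝ) < m := by exact_mod_cast h3
    rw [mul_div_assoc', lt_div_iff₀ h3'] at h2
    linarith
  refine (dimH_mono hcover).trans ?_
  rw [dimH_iUnion]
  refine iSup_le fun N => dimH_le_of_hausdorffMeasure_ne_top (ne_top_of_le_ne_top ENNReal.one_ne_top
    ?_)
  let cyl : ∀ m : ℕ, (Fin m → Digit p n) → Set ℚ_[p] := fun m w =>
    code '' {ω | ω ∈ Ω N ∧ ∀ i : Fin m, ω i = w i}
  have hdiam : ∀ m w ω, ω ∈ Ω N → (∀ i : Fin m, ω i = w i) →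
      Metric.ediam (cyl m w) ≤ ENNReal.ofReal ((p : ℝ) ^ expoSum m ω)⁻¹ := by
    intro m w ω _ hω
    refine Metric.ediam_le ?_
    rintro _ ⟨ω₁, ⟨_, h1⟩, rfl⟩ _ ⟨ω₂, ⟨_, h2⟩, rfl⟩
    rw [edist_dist, dist_eq_norm]
    refine ENNReal.ofReal_le_ofReal ?_
    rw [expoSum_congr (ω' := ω₁) fun i hi => (hω ⟨i, hi⟩).trans (h1 ⟨i, hi⟩).symm]
    exact norm_code_sub_le fun i hi => (h1 ⟨i, hi⟩).trans (h2 ⟨i, hi⟩).symm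
  -- On `Ω N`, for `m ≥ N`, the diameter bound gives `p^{-s S_m} ≤ p^{-t S_m} e^{-mL}`, the Gibbs
  -- weight of the word. These weights sum to 1.
  let π : Digit p n → ℝ := fun d => Real.exp (-t * (expo d * Real.log p) - L)
  have hπ1 : ∑ d, π d = 1 := by
    have hZ := partitionSum_pos (p := p) hn t
    simp only [π, Real.exp_sub]
    rw [← Finset.sum_div, hL, Real.exp_log hZ]
    exact div_self hZ.ne'
  refine (Measure.hausdorffMeasure_le_liminf_sum (s : ℝ) (code '' Ω N) (l := atTop)
    (fun m : ℕ => ENNReal.ofReal ((p : ℝ) ^ m)⁻¹) ?_ cyl ?_ ?_).trans ?_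
  · rw [← ENNReal.ofReal_zero]
    exact ENNReal.tendsto_ofReal (tendsto_inv_atTop_zero.comp
      (tendsto_pow_atTop_atTop_of_one_lt one_lt_prime_cast))
  · refine Eventually.of_forall fun m w => ?_
    by_cases h : ∃ ω ∈ Ω N, ∀ i : Fin m, ω i = w i
    · obtain ⟨ω, h1, h2⟩ := h
      refine (hdiam m w ω h1 h2).trans (ENNReal.ofReal_le_ofReal ?_)
      exact inv_anti₀ (pow_pos prime_cast_pos _)
        (pow_le_pow_right₀ one_lt_prime_cast.le (le_expoSum m ω))
    · have : cyl m w = ∅ := by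
        simp only [cyl, Set.image_eq_empty]
        exact Set.eq_empty_of_forall_notMem fun ω hω => h ⟨ω, hω⟩
      simp [this]
  · refine Eventually.of_forall fun m => ?_
    rintro _ ⟨ω, hω, rfl⟩
    exact Set.mem_iUnion.mpr ⟨fun i => ω i, ω, ⟨hω, fun i => rfl⟩, rfl⟩
  · have hbound : ∀ m ≥ N, ∑ w, Metric.ediam (cyl m w) ^ (s : ℝ) ≤ 1 := by
      intro m hm
      have hsum : ∑ w : Fin m → Digit p n, ENNReal.ofReal (∏ i, π (w i)) = 1 := by
        rw [← ENNReal.ofReal_sum_of_nonneg fun w _ =>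
          Finset.prod_nonneg fun i _ => (Real.exp_pos _).le, sum_prod_eq_one fun _ => hπ1,
          ENNReal.ofReal_one]
      rw [← hsum]
      refine Finset.sum_le_sum fun w _ => ?_
      by_cases h : ∃ ω ∈ Ω N, ∀ i : Fin m, ω i = w i
      · obtain ⟨ω, h1, h2⟩ := h
        refine (ENNReal.rpow_le_rpow (hdiam m w ω h1 h2) hs0.le).trans ?_
        rw [inv_pow_expoSum_eq_exp, ENNReal.ofReal_rpow_of_pos (Real.exp_pos _)]
        refine ENNReal.ofReal_le_ofReal ?_
        have hprod : ∏ i, π (w i) = Real.exp (-t * (expoSum m ω * Real.log p) - m * L) := by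
          rw [← Real.exp_sum, Finset.sum_sub_distrib, ← Finset.mul_sum, ← Finset.sum_mul]
          simp only [← h2]
          rw [Fin.sum_univ_eq_sum_range fun i => (expo (ω i) : ℝ), expoSum]
          simp
        rw [hprod, ← Real.exp_mul, Real.exp_le_exp]
        have := h1 m hm
        linarith
      · have : cyl m w = ∅ := by
          simp only [cyl, Set.image_eq_empty]
          exact Set.eq_empty_of_forall_notMem fun ω hω => h ⟨ω, hω⟩
        simp [this, ENNReal.zero_rpow_of_pos hs0]
    refine (liminf_le_liminf (v := fun _ : ℕ => (1 : ℝ≥0∞)) ?_).trans_eq (liminf_const _)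
    filter_upwards [eventually_ge_atTop N] with m hm using hbound m hm

/-- The mass distribution principle for the image of a Bernoulli measure: a set of digit sequences
of positive measure whose cylinders have mass at most `p^{-s(S + n)}` has an image of positive
`s`-dimensional measure. -/
lemma map_code_le_hausdorffMeasure (ν : Measure (Digit p n)) [IsProbabilityMeasure ν] {s : ℝ}
    (hs : 0 < s) (N : ℕ) {G : Set (ℕ → Digit p n)}
    (hG : ∀ ω ∈ G, ∀ m ≥ N, ∏ i ∈ Finset.range m, ν.real {ω i} ≤
      Real.exp (-s * ((expoSum m ω + n) * Real.log p))) :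
    ((bernoulli ν).restrict G).map code ≤ Measure.hausdorffMeasure s := by
  have hp := prime_cast_pos (p := p)
  have hlp := log_prime_pos (p := p)
  -- The first `N` exponents sum to at most `n * N`, so a cylinder of radius at most `ε` has rank
  -- above `N`, where the mass bound is available.
  set ε : ℝ := ((p : ℝ) ^ (n * N + 1))⁻¹ with hε
  have hε0 : 0 < ε := inv_pos.mpr (pow_pos hp _)
  refine Measure.le_hausdorffMeasure s _ (ENNReal.ofReal ε) (ENNReal.ofReal_pos.mpr hε0) ?_
  intro B hB
  have hBtop : Metric.ediam B ≠ ∞ := ne_top_of_le_ne_top ENNReal.ofReal_ne_top hB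
  have hcl : MeasurableSet (code (p := p) (n := n) ⁻¹' closure B) :=
    measurable_code isClosed_closure.measurableSet
  -- `B` is arbitrary; its closure is measurable and has the same diameter.
  refine (measure_mono subset_closure).trans ?_
  rw [Measure.map_apply measurable_code isClosed_closure.measurableSet, Measure.restrict_apply hcl]
  rcases (code (p := p) (n := n) ⁻¹' closure B ∩ G).eq_empty_or_nonempty with h0 | ⟨ω, hωB, hωG⟩
  · simp [h0]
  have hdist : ∀ ω' ∈ code (p := p) (n := n) ⁻¹' closure B ∩ G,
      ‖code ω - code ω'‖ ≤ (Metric.ediam B).toReal := by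
    intro ω' hω'
    rw [← dist_eq_norm, dist_edist]
    refine ENNReal.toReal_mono hBtop ?_
    rw [← Metric.ediam_closure]
    exact Metric.edist_le_ediam_of_mem hωB hω'.1
  -- The scale `δ` is kept separate from the diameter so that diameter 0 can be treated by letting
  -- `δ → 0`.
  have key : ∀ δ : ℝ, 0 < δ → δ ≤ ε → (Metric.ediam B).toReal ≤ δ →
      bernoulli ν (code ⁻¹' closure B ∩ G) ≤ ENNReal.ofReal (δ ^ s) := by
    intro δ hδ hδε hBδ
    have hex : ∃ k, ((p : ℝ) ^ expoSum k ω)⁻¹ ≤ δ := by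
      obtain ⟨k, hk⟩ := pow_unbounded_of_one_lt δ⁻¹ (one_lt_prime_cast (p := p))
      refine ⟨k, inv_le_of_inv_le₀ hδ (hk.le.trans ?_)⟩
      exact pow_le_pow_right₀ one_lt_prime_cast.le (le_expoSum k ω)
    have hfind := Nat.find_spec hex
    have hmin := fun j => Nat.find_min hex (m := j)
    -- At the first rank `k` with radius at most `δ`, the cylinder of rank `k - 1` still contains
    -- the whole set. The lost digit is at most `n`, which is the `+ n` in the hypothesis on `G`.
    set k := Nat.find hex
    have hNk : N < k := by
      by_contra hcon
      have h1 : expoSum k ω ≤ n * N := (expoSum_mono ω (not_lt.mp hcon)).trans (expoSum_le N ω)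
      have h2 : ε < ((p : ℝ) ^ expoSum k ω)⁻¹ :=
        inv_strictAnti₀ (pow_pos hp _) (pow_lt_pow_right₀ one_lt_prime_cast (by omega))
      linarith
    obtain ⟨m, hm⟩ : ∃ m, k = m + 1 := ⟨k - 1, by omega⟩
    have hlt : δ < ((p : ℝ) ^ expoSum m ω)⁻¹ := not_le.mp (hmin m (by omega))
    have hsub : code ⁻¹' closure B ∩ G ⊆ {ω' | ∀ i < m, ω' i = ω i} := fun ω' hω' i hi =>
      (eq_of_norm_code_sub_lt (((hdist ω' hω').trans hBδ).trans_lt hlt) i hi).symm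
    refine (measure_mono hsub).trans ?_
    rw [← ofReal_measureReal, bernoulli_real_cylinder]
    refine ENNReal.ofReal_le_ofReal ((hG ω hωG m (by omega)).trans ?_)
    refine le_trans ?_ (Real.rpow_le_rpow (inv_pos.mpr (pow_pos hp _)).le hfind hs.le)
    rw [inv_pow_expoSum_eq_exp, ← Real.exp_mul, Real.exp_le_exp, hm, expoSum_succ]
    have h1 : (expo (ω m) : ℝ) ≤ n := by exact_mod_cast expo_le _
    push_cast
    nlinarith [mul_le_mul_of_nonneg_left h1 (mul_pos hs hlp).le]
  rcases ENNReal.toReal_nonneg (a := Metric.ediam B).eq_or_lt with h0 | h0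
  · have hlim : Tendsto (fun δ : ℝ => ENNReal.ofReal (δ ^ s)) (𝓝[>] 0) (𝓝 0) := by
      have h1 : Tendsto (fun δ : ℝ => δ ^ s) (𝓝[>] 0) (𝓝 0) := by
        have := (Real.continuousAt_rpow_const 0 s (Or.inr hs.le)).tendsto
        rw [Real.zero_rpow hs.ne'] at this
        exact this.mono_left nhdsWithin_le_nhds
      simpa using ENNReal.tendsto_ofReal h1
    refine (ge_of_tendsto hlim ?_).trans zero_le
    filter_upwards [Ioc_mem_nhdsGT hε0] with δ hδ
    exact key δ hδ.1 hδ.2 (by rw [← h0]; exact hδ.1.le)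
  · have h1 := key _ h0 (ENNReal.toReal_le_of_le_ofReal hε0.le hB) le_rfl
    rwa [← ENNReal.ofReal_rpow_of_pos h0, ENNReal.ofReal_toReal hBtop] at h1

/-- The dimension of `approxSet p n α` is at least entropy divided by `α`, for each law on the
digits with Lyapunov exponent `α`. -/
theorem le_dimH_approxSet (ν : Measure (Digit p n)) [IsProbabilityMeasure ν] {α : ℝ} (hα : 0 < α)
    (hmean : ∑ d, ν.real {d} * (expo d * Real.log p) = α) :
    ENNReal.ofReal (1 / α * ∑ d, Real.negMulLog (ν.real {d})) ≤ dimH (approxSet p n α) := by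
  set H := ∑ d, Real.negMulLog (ν.real {d}) with hH
  refine le_of_forall_lt_imp_le_of_dense fun a ha => ?_
  lift a to ℝ≥0 using ha.ne_top
  rcases eq_or_ne a 0 with rfl | ha0
  · simp
  have hs0 : (0 : ℝ) < a := by exact_mod_cast pos_iff_ne_zero.mpr ha0
  have hs : (a : ℝ) < 1 / α * H := by
    rw [← ENNReal.ofReal_coe_nnreal] at ha
    exact (ENNReal.ofReal_lt_ofReal_iff_of_nonneg hs0.le).mp ha
  have hsH : (a : ℝ) * α < H := by
    rwa [one_div, lt_inv_mul_iff₀ hα, mul_comm] at hs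
  have hH' : ∑ d, ν.real {d} * -Real.log (ν.real {d}) = H := by
    rw [hH]
    exact Finset.sum_congr rfl fun d _ => by rw [Real.negMulLog]; ring
  -- Almost surely `-log` of the cylinder mass grows like `mH` and `(S_m + n) log p` like `mα`.
  -- Since `aα < H`, almost every sequence lies in some `G N`.
  let G : ℕ → Set (ℕ → Digit p n) := fun N =>
    {ω | ∀ m ≥ N, ∏ i ∈ Finset.range m, ν.real {ω i} ≤
      Real.exp (-a * ((expoSum m ω + n) * Real.log p))}
  have hA : ∀ᵐ ω ∂bernoulli ν, code ω ∈ approxSet p n α := by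
    filter_upwards [ae_tendsto_average ν fun d => expo d * Real.log p] with ω hω
    rw [code_mem_approxSet_iff]
    rw [hmean] at hω
    refine hω.congr fun m => ?_
    rw [← Finset.sum_mul, expoSum]
    push_cast
    rfl
  have hG : ∀ᵐ ω ∂bernoulli ν, ω ∈ ⋃ N, G N := by
    filter_upwards [ae_tendsto_average ν fun d => -Real.log (ν.real {d}), hA] with ω h1 h2
    rw [hH'] at h1
    have h3 := (((code_mem_approxSet_iff ω α).mp h2).add
      (tendsto_const_div_atTop_nhds_zero_nat ((n : ℝ) * Real.log p))).const_mul (a : ℝ)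
    rw [add_zero] at h3
    obtain ⟨N, hN⟩ := eventually_atTop.mp ((h3.eventually_lt h1 hsH).and (eventually_gt_atTop 0))
    refine Set.mem_iUnion.mpr ⟨N, fun m hm => ?_⟩
    obtain ⟨h4, h5⟩ := hN m hm
    have h5' : (0 : ℝ) < m := by exact_mod_cast h5
    rw [← add_div, mul_div_assoc', div_lt_div_iff_of_pos_right h5', Finset.sum_neg_distrib] at h4
    -- Laws with null digits are allowed, as the end points require; a null digit makes the product
    -- vanish, so logarithms are taken only when all factors are positive.
    by_cases hz : ∃ i ∈ Finset.range m, ν.real {ω i} = 0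
    · obtain ⟨i, hi, hi0⟩ := hz
      rw [Finset.prod_eq_zero hi hi0]
      exact (Real.exp_pos _).le
    · push Not at hz
      have hpos : ∀ i ∈ Finset.range m, 0 < ν.real {ω i} :=
        fun i hi => measureReal_nonneg.lt_of_ne (hz i hi).symm
      rw [← Real.exp_log (Finset.prod_pos hpos), Real.log_prod hz, Real.exp_le_exp]
      linarith
  obtain ⟨N, hN⟩ : ∃ N, bernoulli ν (G N) ≠ 0 := by
    by_contra! hcon
    have h1 : bernoulli ν (⋃ N, G N) = 0 := measure_iUnion_null hcon
    have h2 := prob_compl_eq_zero_iff₀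
      (NullMeasurableSet.of_null h1) |>.mp (by rwa [← mem_ae_iff])
    rw [h1] at h2
    exact zero_ne_one h2
  refine le_dimH_of_hausdorffMeasure_ne_zero fun h0 => hN ?_
  have h1 := map_code_le_hausdorffMeasure ν hs0 N (G := G N) fun ω hω => hω
  -- Measurability of `approxSet` is not needed: the inequality valid for arbitrary sets points in
  -- the right direction.
  have h2 := (Measure.le_map_apply measurable_code.aemeasurable (approxSet p n α)).trans
    ((h1 _).trans_eq h0)
  rw [le_zero_iff] at h2
  have h3 : ∀ᵐ ω ∂(bernoulli ν).restrict (G N), code ω ∉ approxSet p n α := by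
    rw [ae_iff]
    simpa using! h2
  have h4 : ∀ᵐ ω ∂(bernoulli ν).restrict (G N), False := by
    filter_upwards [h3, ae_restrict_of_ae hA] with ω h5 h6 using h5 h6
  rw [ae_iff] at h4
  simpa using h4

end Dimension

/-! ### Monotone exponential sums and geometric sums -/

section ExponentialSums

lemma strictAnti_mul_exp {c : ℝ} (hc : c ≠ 0) : StrictAnti fun t : ℝ => c * Real.exp (-t * c) := by
  intro t u htu
  rcases hc.lt_or_gt with h | h
  · exact mul_lt_mul_of_neg_left (Real.exp_lt_exp.mpr (by nlinarith)) h
  · exact mul_lt_mul_of_pos_left (Real.exp_lt_exp.mpr (by nlinarith)) h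

lemma strictAnti_sum_mul_exp {ι : Type*} {s : Finset ι} {c : ι → ℝ} {j : ι} (hj : j ∈ s)
    (hc : c j ≠ 0) : StrictAnti fun t : ℝ => ∑ i ∈ s, c i * Real.exp (-t * c i) := by
  intro t u htu
  refine Finset.sum_lt_sum (fun i _ => ?_) ⟨j, hj, strictAnti_mul_exp hc htu⟩
  rcases eq_or_ne (c i) 0 with h | h
  · simp [h]
  · exact (strictAnti_mul_exp h htu).le

lemma exists_sum_mul_exp_nonpos {ι : Type*} {s : Finset ι} {c : ι → ℝ} {j : ι} (hj : j ∈ s)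
    (hc : c j < 0) : ∃ t : ℝ, ∑ i ∈ s, c i * Real.exp (-t * c i) ≤ 0 := by
  classical
  set M := ∑ i ∈ s, |c i| with hM
  have hM0 : 0 ≤ M := Finset.sum_nonneg fun i _ => abs_nonneg _
  have hc2 : 0 < c j ^ 2 := sq_pos_iff.mpr hc.ne
  -- By `1 + x ≤ e^x`, the `j`-th term is at most `c j - M ≤ -M`, while the other terms add up to at
  -- most `M - |c j|`.
  set t := M / c j ^ 2 with ht
  have ht0 : 0 ≤ t := div_nonneg hM0 hc2.le
  refine ⟨t, ?_⟩
  have h1 : c j * Real.exp (-t * c j) ≤ -M := by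
    have h2 := mul_le_mul_of_nonpos_left (Real.add_one_le_exp (-t * c j)) hc.le
    have h3 : t * c j ^ 2 = M := div_mul_cancel₀ M hc2.ne'
    nlinarith
  have h4 : ∑ i ∈ s.erase j, c i * Real.exp (-t * c i) ≤ ∑ i ∈ s.erase j, |c i| := by
    refine Finset.sum_le_sum fun i _ => ?_
    rcases le_total (c i) 0 with h | h
    · exact (mul_nonpos_of_nonpos_of_nonneg h (Real.exp_pos _).le).trans (abs_nonneg _)
    · rw [abs_of_nonneg h]
      refine mul_le_of_le_one_right h (Real.exp_le_one_iff.mpr ?_)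
      nlinarith
  have h5 : |c j| + ∑ i ∈ s.erase j, |c i| = M := Finset.add_sum_erase s (fun i => |c i|) hj
  rw [← Finset.add_sum_erase s _ hj]
  have := abs_nonneg (c j)
  linarith

lemma existsUnique_sum_mul_exp_eq_zero {ι : Type*} {s : Finset ι} {c : ι → ℝ} {j k : ι}
    (hj : j ∈ s) (hcj : c j < 0) (hk : k ∈ s) (hck : 0 < c k) :
    ∃! t : ℝ, ∑ i ∈ s, c i * Real.exp (-t * c i) = 0 := by
  have hcont : Continuous fun t : ℝ => ∑ i ∈ s, c i * Real.exp (-t * c i) := by fun_prop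
  have h2 : ∃ t : ℝ, 0 ≤ ∑ i ∈ s, c i * Real.exp (-t * c i) := by
    -- Changing the signs of both `c` and `t` negates the sum, which gives the opposite sign.
    obtain ⟨t, ht⟩ := exists_sum_mul_exp_nonpos (c := fun i => -c i) hk (neg_lt_zero.mpr hck)
    refine ⟨-t, ?_⟩
    simp only [neg_mul, Finset.sum_neg_distrib, mul_neg, neg_neg] at ht ⊢
    linarith
  obtain ⟨t, ht⟩ := mem_range_of_exists_le_of_exists_ge hcont (exists_sum_mul_exp_nonpos hj hcj) h2
  refine ⟨t, ht, fun u hu => ?_⟩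
  exact (strictAnti_sum_mul_exp hj hcj.ne).injective (hu.trans ht.symm)

lemma sum_inv_pow {u : ℝ} (hu : u ≠ 0) (hu1 : u - 1 ≠ 0) (n : ℕ) :
    ∑ i ∈ Finset.range n, u⁻¹ ^ (i + 1) = (u ^ n - 1) / (u ^ n * (u - 1)) := by
  induction n with
  | zero => simp
  | succ n ih =>
    rw [Finset.sum_range_succ, ih, inv_pow]
    field_simp
    ring

lemma sum_mul_inv_pow {u : ℝ} (hu : u ≠ 0) (hu1 : u - 1 ≠ 0) (n : ℕ) :
    ∑ i ∈ Finset.range n, ((i : ℝ) + 1) * u⁻¹ ^ (i + 1) =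
      u * (u ^ n - 1) / (u ^ n * (u - 1) ^ 2) - n / (u ^ n * (u - 1)) := by
  induction n with
  | zero => simp
  | succ n ih =>
    rw [Finset.sum_range_succ, ih, inv_pow]
    push_cast
    field_simp
    ring

lemma sum_range_add_one (n : ℕ) :
    ∑ i ∈ Finset.range n, ((i : ℝ) + 1) = n * ((n + 1) / 2) := by
  induction n with
  | zero => simp
  | succ n ih =>
    rw [Finset.sum_range_succ, ih]
    push_cast
    ring

end ExponentialSums

/-! ### The slope equation -/

section Slope

variable {p n : ℕ}

lemma sum_digit_eq (f : ℕ → ℝ) :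
    ∑ d : Digit p n, f (expo d) = (p - 1 : ℕ) * ∑ i ∈ Finset.range n, f (i + 1) := by
  rw [Fintype.sum_prod_type, Finset.mul_sum, ← Fin.sum_univ_eq_sum_range
    fun i => ((p - 1 : ℕ) : ℝ) * f (i + 1)]
  simp [expo]

variable [Fact p.Prime]

/-- `slope p n t` is the logarithmic derivative of `∑ p^{-ta}`. -/
lemma slope_mul_sum (hn : 1 ≤ n) (t : ℝ) :
    slope p n t * ∑ i ∈ Finset.range n, Real.exp (-t * (((i : ℝ) + 1) * Real.log p)) =
      -Real.log p *
        ∑ i ∈ Finset.range n, ((i : ℝ) + 1) * Real.exp (-t * (((i : ℝ) + 1) * Real.log p)) := by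
  rcases eq_or_ne t 0 with rfl | ht
  · simp only [slope, if_true, neg_zero, zero_mul, Real.exp_zero, mul_one, sum_range_add_one,
      Finset.sum_const, Finset.card_range, nsmul_eq_mul]
    ring
  · have hp := prime_cast_pos (p := p)
    -- In the variable `u` both sums are geometric; `u ≠ 1` is where `t ≠ 0` enters.
    set u : ℝ := (p : ℝ) ^ t with hu
    have hu0 : 0 < u := Real.rpow_pos_of_pos hp t
    have hu1 : u ≠ 1 := by
      rw [hu, Real.rpow_def_of_pos hp, Ne, Real.exp_eq_one_iff]
      exact mul_ne_zero log_prime_pos.ne' ht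
    have hun : u ^ n - 1 ≠ 0 := by
      rw [sub_ne_zero, Ne, pow_eq_one_iff_of_nonneg hu0.le (by omega)]
      exact hu1
    have hexp : ∀ i : ℕ, Real.exp (-t * (((i : ℝ) + 1) * Real.log p)) = u⁻¹ ^ (i + 1) := fun i => by
      rw [hu, Real.rpow_def_of_pos hp, ← Real.exp_neg, ← Real.exp_nat_mul]
      push_cast
      congr 1
      ring
    simp only [hexp]
    rw [sum_inv_pow hu0.ne' (sub_ne_zero.mpr hu1), sum_mul_inv_pow hu0.ne' (sub_ne_zero.mpr hu1),
      slope, if_neg ht, Real.rpow_mul hp.le, Real.rpow_natCast, ← hu]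
    have := sub_ne_zero.mpr hu1
    field_simp
    ring

/-- The equation says that `a · log p` has mean `α` under weights proportional to `p^{-ta}`. The
residues would only contribute a common factor `p - 1`. -/
lemma neg_eq_slope_iff (hn : 1 ≤ n) (α t : ℝ) :
    -α = slope p n t ↔
      ∑ i ∈ Finset.range n, (((i : ℝ) + 1) * Real.log p - α) *
        Real.exp (-t * (((i : ℝ) + 1) * Real.log p)) = 0 := by
  have hS : 0 < ∑ i ∈ Finset.range n, Real.exp (-t * (((i : ℝ) + 1) * Real.log p)) :=
    Finset.sum_pos (fun _ _ => Real.exp_pos _) ⟨0, Finset.mem_range.mpr hn⟩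
  have h := slope_mul_sum (p := p) hn t
  have h2 : ∑ i ∈ Finset.range n, (((i : ℝ) + 1) * Real.log p - α) *
        Real.exp (-t * (((i : ℝ) + 1) * Real.log p)) =
      (-α - slope p n t) *
        ∑ i ∈ Finset.range n, Real.exp (-t * (((i : ℝ) + 1) * Real.log p)) := by
    rw [sub_mul, h, Finset.mul_sum, Finset.mul_sum, ← Finset.sum_sub_distrib]
    exact Finset.sum_congr rfl fun i _ => by ring
  rw [h2, mul_eq_zero, or_iff_left hS.ne', sub_eq_zero]

/-- Multiplication by `e^{tα}` centres the exponents at `α`. For `α` in the open interval the first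
centred exponent is negative and the last one positive. -/
theorem existsUnique_slope (hn : 1 ≤ n) {α : ℝ} (hα : α ∈ Set.Ioo (Real.log p) (n * Real.log p)) :
    ∃! t : ℝ, -α = slope p n t := by
  have h1 := existsUnique_sum_mul_exp_eq_zero (s := Finset.range n)
    (c := fun i : ℕ => ((i : ℝ) + 1) * Real.log p - α) (j := 0) (k := n - 1)
    (Finset.mem_range.mpr hn) (by simpa using hα.1) (Finset.mem_range.mpr (by omega)) (by
      rw [Nat.cast_sub hn]
      simpa using hα.2)
  refine (existsUnique_congr fun t => ?_).mp h1
  have h2 : ∑ i ∈ Finset.range n, (((i : ℝ) + 1) * Real.log p - α) *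
        Real.exp (-t * (((i : ℝ) + 1) * Real.log p - α)) =
      Real.exp (t * α) * ∑ i ∈ Finset.range n, (((i : ℝ) + 1) * Real.log p - α) *
        Real.exp (-t * (((i : ℝ) + 1) * Real.log p)) := by
    rw [Finset.mul_sum]
    refine Finset.sum_congr rfl fun i _ => ?_
    rw [show -t * (((i : ℝ) + 1) * Real.log p - α) =
      t * α + -t * (((i : ℝ) + 1) * Real.log p) by ring, Real.exp_add]
    ring
  rw [neg_eq_slope_iff hn, h2, mul_eq_zero, or_iff_right (Real.exp_pos _).ne']

end Slope

/-! ### Matching the two bounds, inside the interval and at its ends -/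

section Spectrum

open scoped ENNReal

variable {p n : ℕ} [Fact p.Prime]

lemma coe_dimH_eq {A : Set ℚ_[p]} {x : ℝ} (hx : 0 ≤ x) (h : dimH A = ENNReal.ofReal x) :
    ((dimH A : ℝ≥0∞) : EReal) = (x : EReal) := by
  rw [h, EReal.coe_ennreal_ofReal, max_eq_left hx]

/-- A solution of the slope equation gives the dimension. -/
theorem dimH_approxSet_of_slope (hn : 1 ≤ n) {α t : ℝ} (hα : 0 < α) (ht : -α = slope p n t) :
    ((dimH (approxSet p n α) : ℝ≥0∞) : EReal) =
      ((1 / α * Real.log (partitionSum p n t) + t : ℝ) : EReal) := by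
  set Z := partitionSum p n t with hZ
  have hZ0 : 0 < Z := partitionSum_pos hn t
  let π : Digit p n → ℝ := fun d => Real.exp (-t * (expo d * Real.log p)) / Z
  have hπ : ∀ d, 0 < π d := fun d => div_pos (Real.exp_pos _) hZ0
  have hπ1 : ∑ d, π d = 1 := by
    rw [← Finset.sum_div]
    exact div_self hZ0.ne'
  obtain ⟨ν, hν, hνπ⟩ := exists_measure_real_singleton (fun d => (hπ d).le) hπ1
  have hzero : ∑ d : Digit p n, (expo d * Real.log p - α) *
      Real.exp (-t * (expo d * Real.log p)) = 0 := by
    rw [sum_digit_eq fun k => ((k : ℝ) * Real.log p - α) * Real.exp (-t * (k * Real.log p))]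
    push_cast
    rw [(neg_eq_slope_iff hn α t).mp ht, mul_zero]
  have hmean : ∑ d, π d * (expo d * Real.log p) = α := by
    have h1 : ∑ d, π d * (expo d * Real.log p) - α * ∑ d, π d = 0 := by
      rw [Finset.mul_sum, ← Finset.sum_sub_distrib, ← zero_div Z, ← hzero, Finset.sum_div]
      exact Finset.sum_congr rfl fun d _ => by simp only [π]; ring
    rw [hπ1] at h1
    linarith
  have hH : 1 / α * ∑ d, Real.negMulLog (π d) = 1 / α * Real.log Z + t := by
    have h1 : ∀ d, Real.negMulLog (π d) =
        t * (π d * (expo d * Real.log p)) + π d * Real.log Z := fun d => by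
      rw [Real.negMulLog, Real.log_div (Real.exp_pos _).ne' hZ0.ne', Real.log_exp]
      ring
    simp only [h1]
    rw [Finset.sum_add_distrib, ← Finset.mul_sum, hmean, ← Finset.sum_mul, hπ1]
    field_simp
    ring
  -- Entropy is nonnegative, so the truncation in `ENNReal.ofReal` changes nothing.
  have hH0 : 0 ≤ 1 / α * ∑ d, Real.negMulLog (π d) :=
    mul_nonneg (one_div_pos.mpr hα).le (Finset.sum_nonneg fun d _ =>
      Real.negMulLog_nonneg (hπ d).le (hπ1 ▸
        Finset.single_le_sum (fun d _ => (hπ d).le) (Finset.mem_univ d)))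
  rw [hH] at hH0
  refine coe_dimH_eq hH0 (le_antisymm (dimH_approxSet_le hn hα t) ?_)
  have h := le_dimH_approxSet ν hα (by simpa only [hνπ] using hmean)
  simp only [hνπ] at h
  rwa [hH] at h

/-- The uniform law on the digits with a given exponent has entropy `log (p - 1)`. -/
lemma le_dimH_approxSet_of_fixed_exponent (i₀ : Fin n) :
    ENNReal.ofReal (1 / (((i₀ : ℝ) + 1) * Real.log p) * Real.log (p - 1 : ℕ)) ≤
      dimH (approxSet p n (((i₀ : ℝ) + 1) * Real.log p)) := by
  have hα : 0 < ((i₀ : ℝ) + 1) * Real.log p := mul_pos (by positivity) log_prime_pos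
  have hp1 : (0 : ℝ) < (p - 1 : ℕ) := by
    exact_mod_cast Nat.sub_pos_of_lt (Fact.out : p.Prime).one_lt
  let π : Digit p n → ℝ := fun d => if d.1 = i₀ then ((p - 1 : ℕ) : ℝ)⁻¹ else 0
  have hsum : ∀ g : ℝ → ℝ, g 0 = 0 → ∑ d, g (π d) = (p - 1 : ℕ) * g ((p - 1 : ℕ) : ℝ)⁻¹ := by
    intro g hg
    have : ∀ d, g (π d) = if d.1 = i₀ then g ((p - 1 : ℕ) : ℝ)⁻¹ else 0 := fun d => by
      simp only [π]; split_ifs <;> simp [hg]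
    simp only [this]
    rw [Fintype.sum_prod_type_right]
    simp
  have hπ1 : ∑ d, π d = 1 := by
    have := hsum id rfl
    simp only [id] at this
    rw [this, mul_inv_cancel₀ hp1.ne']
  obtain ⟨ν, hν, hνπ⟩ := exists_measure_real_singleton
    (fun d => show 0 ≤ π d by simp only [π]; split_ifs; exacts [(inv_pos.mpr hp1).le, le_rfl]) hπ1
  have h := le_dimH_approxSet ν hα (by
    have : ∀ d, π d * (expo d * Real.log p) = π d * (((i₀ : ℝ) + 1) * Real.log p) := fun d => by
      simp only [π]
      split_ifs with hd
      · simp [expo, hd]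
      · simp
    simp only [hνπ, this]
    rw [← Finset.sum_mul, hπ1, one_mul])
  simp only [hνπ] at h
  rw [hsum _ Real.negMulLog_zero, Real.negMulLog, Real.log_inv] at h
  convert h using 3
  field_simp

/-- The formula equals `(1/α) log ∑ e^{-t(a log p - α)}`; in the limit only the `p - 1` digits with
exponent `i₀ + 1` survive. The hypothesis on `l` covers both `t → +∞` with `i₀` minimal and `t → -∞`
with `i₀` maximal. -/
lemma tendsto_dimension_formula (i₀ : Fin n) {l : Filter ℝ}
    (hl : ∀ i : Fin n, i ≠ i₀ → Tendsto (fun t : ℝ => -t * ((i : ℝ) - i₀)) l atBot) :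
    Tendsto (fun t : ℝ => 1 / (((i₀ : ℝ) + 1) * Real.log p) * Real.log (partitionSum p n t) + t) l
      (𝓝 (1 / (((i₀ : ℝ) + 1) * Real.log p) * Real.log (p - 1 : ℕ))) := by
  have hlp := log_prime_pos (p := p)
  set α := ((i₀ : ℝ) + 1) * Real.log p with hα
  have hα0 : 0 < α := mul_pos (by positivity) hlp
  have hn : 1 ≤ n := by have := i₀.pos; omega
  have hp1 : (0 : ℝ) < (p - 1 : ℕ) := by
    exact_mod_cast Nat.sub_pos_of_lt (Fact.out : p.Prime).one_lt
  have hterm : ∀ d : Digit p n, Tendsto (fun t : ℝ => Real.exp (-t * (expo d * Real.log p - α))) l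
      (𝓝 (if d.1 = i₀ then 1 else 0)) := by
    intro d
    have he : ∀ t : ℝ, -t * (expo d * Real.log p - α) =
        -t * ((d.1 : ℝ) - i₀) * Real.log p := fun t => by
      rw [hα, expo]
      push_cast
      ring
    simp only [he]
    split_ifs with hd
    · simpa [hd] using tendsto_const_nhds
    · exact Real.tendsto_exp_atBot.comp ((hl d.1 hd).atBot_mul_const hlp)
  have hsum := tendsto_finsetSum Finset.univ fun d (_ : d ∈ Finset.univ) => hterm d
  have hcard : ∑ d : Digit p n, (if d.1 = i₀ then (1 : ℝ) else 0) = (p - 1 : ℕ) := by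
    rw [Fintype.sum_prod_type_right]
    simp
  rw [hcard] at hsum
  refine ((hsum.log hp1.ne').const_mul (1 / α)).congr fun t => ?_
  have hfac : ∑ d : Digit p n, Real.exp (-t * (expo d * Real.log p - α)) =
      Real.exp (t * α) * partitionSum p n t := by
    rw [partitionSum, Finset.mul_sum]
    refine Finset.sum_congr rfl fun d _ => ?_
    rw [← Real.exp_add]
    congr 1
    ring
  rw [hfac, Real.log_mul (Real.exp_pos _).ne' (partitionSum_pos hn t).ne', Real.log_exp]
  field_simp
  ring

/-- The upper bound holds for every `t`, hence in the limit, and the uniform law on the digits of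
exponent `i₀ + 1` attains that limit. -/
theorem tendsto_dimH_of_fixed_exponent (i₀ : Fin n) {l : Filter ℝ} [l.NeBot]
    (hl : ∀ i : Fin n, i ≠ i₀ → Tendsto (fun t : ℝ => -t * ((i : ℝ) - i₀)) l atBot) :
    Tendsto (fun t : ℝ =>
        ((1 / (((i₀ : ℝ) + 1) * Real.log p) * Real.log (partitionSum p n t) + t : ℝ) : EReal)) l
      (𝓝 ((dimH (approxSet p n (((i₀ : ℝ) + 1) * Real.log p)) : ℝ≥0∞) : EReal)) := by
  have hα0 : 0 < ((i₀ : ℝ) + 1) * Real.log p := mul_pos (by positivity) log_prime_pos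
  have hn : 1 ≤ n := by have := i₀.pos; omega
  have h := tendsto_dimension_formula (p := p) i₀ hl
  have hlog : 0 ≤ Real.log (p - 1 : ℕ) := Real.log_natCast_nonneg _
  rw [coe_dimH_eq (mul_nonneg (one_div_pos.mpr hα0).le hlog) (le_antisymm
    (ge_of_tendsto' (ENNReal.tendsto_ofReal h) fun t => dimH_approxSet_le hn hα0 t)
    (le_dimH_approxSet_of_fixed_exponent i₀)), EReal.tendsto_coe]
  exact h

end Spectrum

end Schneider

end

/-! ### The dimension spectrum -/

theorem theorem5p3 (p : ℕ) [Fact p.Prime] (n : ℕ) (hn : 1 ≤ n) (α : ℝ)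
    (hα : α ∈ Set.Icc (Real.log p) (n * Real.log p)) :
    -- in the interior of the interval, the equation has a unique real solution
    (α ∈ Set.Ioo (Real.log p) (n * Real.log p) → ∃! t : ℝ, -α = Schneider.slope p n t) ∧
    -- every solution gives the dimension
    (∀ t : ℝ, -α = Schneider.slope p n t →
      ((dimH (Schneider.approxSet p n α) : ENNReal) : EReal) =
        ((1 / α : ℝ) : EReal) * Schneider.Pn p n t + (t : EReal)) ∧
    -- at the end points, the solution is to be read as `t = +∞`, respectively `t = -∞`
    (α = Real.log p →
      Filter.Tendsto
        (fun t : ℝ => ((1 / α : ℝ) : EReal) * Schneider.Pn p n t + (t : EReal))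
        Filter.atTop (nhds ((dimH (Schneider.approxSet p n α) : ENNReal) : EReal))) ∧
    (α = n * Real.log p →
      Filter.Tendsto
        (fun t : ℝ => ((1 / α : ℝ) : EReal) * Schneider.Pn p n t + (t : EReal))
        Filter.atBot (nhds ((dimH (Schneider.approxSet p n α) : ENNReal) : EReal))) := by
  have hα0 : 0 < α := Schneider.log_prime_pos.trans_le hα.1
  have hP : ∀ t : ℝ, ((1 / α : ℝ) : EReal) * Schneider.Pn p n t + (t : EReal) =
      ((1 / α * Real.log (Schneider.partitionSum p n t) + t : ℝ) : EReal) := fun t => by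
    rw [Schneider.Pn_eq hn, EReal.coe_add, EReal.coe_mul]
  simp only [hP]
  refine ⟨Schneider.existsUnique_slope hn, fun t ht => Schneider.dimH_approxSet_of_slope hn hα0 ht,
    fun h => ?_, fun h => ?_⟩
  · have h1 : α = (((⟨0, hn⟩ : Fin n) : ℕ) + 1 : ℝ) * Real.log p := by simp [h]
    rw [h1]
    refine Schneider.tendsto_dimH_of_fixed_exponent ⟨0, hn⟩ fun i hi => ?_
    refine Filter.tendsto_neg_atTop_atBot.atBot_mul_const ?_
    have : (i : ℕ) ≠ 0 := fun h0 => hi (Fin.ext h0)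
    simpa using Nat.pos_of_ne_zero this
  · have hn1 : n - 1 < n := by omega
    have h1 : α = (((⟨n - 1, hn1⟩ : Fin n) : ℕ) + 1 : ℝ) * Real.log p := by
      rw [h, Nat.cast_sub hn]
      simp
    rw [h1]
    refine Schneider.tendsto_dimH_of_fixed_exponent ⟨n - 1, hn1⟩ fun i hi => ?_
    refine Filter.tendsto_neg_atBot_atTop.atTop_mul_const_of_neg ?_
    have h2 : (i : ℕ) ≠ n - 1 := fun h0 => hi (Fin.ext h0)
    have h3 : (i : ℕ) < n - 1 := by have := i.2; omega
    rw [sub_neg]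
    exact_mod_cast h3
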